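/- Let $\mathbf m_0,\mathbf m_1,\mathbf m_2$ be three non-collinear points of the Euclidean plane $\mathbb R^2$ (the $x$-plane), put $\mathbf d_{j0}=\mathbf m_j-\mathbf m_0$ for $j=1,2$, and for $i=0,1,2$ let $r_i$ be the line through the two points $\mathbf m_j$ with $j\ne i$. Let $$\boldsymbol\tau_2:\mathbb R^2\to\mathbb R^2,\qquad \mathbf x\mapsto\bigl(\|\mathbf x-\mathbf m_1\|-\|\mathbf x-\mathbf m_0\|,\ \|\mathbf x-\mathbf m_2\|-\|\mathbf x-\mathbf m_0\|\bigr)$$ be the TDOA map, let $$E=\{(\tau_1,\tau_2)\in\mathbb R^2:\ \|\tau_2\mathbf d_{10}-\tau_1\mathbf d_{20}\|^2=\|\mathbf d_{10}\wedge\mathbf d_{20}\|^2\},$$ where $\|\mathbf d_{10}\wedge\mathbf d_{20}\|=|\det(\mathbf d_{10},\mathbf d_{20})|$ (this is an ellipse), and let $\tilde E=\boldsymbol\tau_2^{-1}(E)\subset\mathbb R^2$ be the bifurcation curve. Embed $\mathbb R^2$ in $\mathbb P^2_{\mathbb C}$ by $(x,y)\mapsto(x:y:1)$. The ideal points of a subset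 of $\mathbb R^2$ are the points of its Zariski closure in $\mathbb P^2_{\mathbb C}$ that lie on the line at infinity $z=0$. Then $\tilde E$ is a rational curve of degree $5$, in the following sense. The Zariski closure of $\tilde E$ in $\mathbb P^2_{\mathbb C}$ is the zero locus of an irreducible homogeneous polynomial of degree $5$ over $\mathbb C$; it is a rational curve, that is, its function field is isomorphic over $\mathbb C$ to $\mathbb C(t)$; and there are homogeneous polynomials $P_0,P_1,P_2\in\mathbb R[\mu_1,\mu_2]$ of degree $5$, without common zeros in $\mathbb C^2\setminus\{0\}$, such that $$\tilde E=\Bigl\{\Bigl(\tfrac{P_0(\boldsymbol\mu)}{P_2(\boldsymbol\mu)},\tfrac{P_1(\boldsymbol\mu)}{P_2(\boldsymbol\mu)}\Bigr):\ \boldsymbol\mu\in\mathbb R^2,\ P_2(\boldsymbol\mu)\neq0\Bigr\}.$$ Moreover, the set of ideal points of $\tilde E$ consists exactly of the ideal points of the lines $r_0,r_1,r_2$ and the two cyclic points $(1:i:0)$ and $(1:-i:0)$ of $\mathbb P^2_{\mathbb C}$. -/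

import Mathlib

noncomputable section

namespace TDOA

/-- The Euclidean `x`-plane. -/
abbrev Plane : Type := EuclideanSpace ℝ (Fin 2)

/-- The complex projective plane. Its homogeneous coordinates are written `(x : y : z)`, and the
affine plane is the complement of the line `z = 0`. -/
abbrev ProjPlane : Type := Projectivization ℂ (Fin 3 → ℂ)

/-! ### The TDOA map and the bifurcation curve -/

/-- The displacement vector `d_{ji} = m_j - m_i`. -/
def disp (m : Fin 3 → Plane) (j i : Fin 3) : Plane := m j - m i

/-- The TDOA map `x ↦ (d_1(x) - d_0(x), d_2(x) - d_0(x))`, where `d_i(x) = ‖x - m_i‖`. -/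
def tdoaMap (m : Fin 3 → Plane) (x : Plane) : ℝ × ℝ :=
  (‖x - m 1‖ - ‖x - m 0‖, ‖x - m 2‖ - ‖x - m 0‖)

/-- The coefficient of `e₁ ∧ e₂` in the 2-form `u ∧ v`; its absolute value is `‖u ∧ v‖`. -/
def wedge (u v : Plane) : ℝ := u 0 * v 1 - u 1 * v 0

/-- The polynomial `a(τ) = ‖τ₂ d_{10} - τ₁ d_{20}‖² - ‖d_{10} ∧ d_{20}‖²`. -/
def aPoly (m : Fin 3 → Plane) (τ : ℝ × ℝ) : ℝ :=
  ‖τ.2 • disp m 1 0 - τ.1 • disp m 2 0‖ ^ 2 - wedge (disp m 1 0) (disp m 2 0) ^ 2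

/-- The ellipse `E` in the `τ`-plane. -/
def ellipse (m : Fin 3 → Plane) : Set (ℝ × ℝ) := {τ | aPoly m τ = 0}

/-- The bifurcation curve: the inverse image of the ellipse under the TDOA map. -/
def bifurcationCurve (m : Fin 3 → Plane) : Set Plane := tdoaMap m ⁻¹' ellipse m

/-! ### Plane curves in the complex projective plane -/

theorem affineVec_ne_zero (a b : ℂ) : (![a, b, 1] : Fin 3 → ℂ) ≠ 0 := fun h => by
  simpa using congrFun h 2

/-- The point `(a : b : 1)` of the projective plane. -/
def affinePoint (a b : ℂ) : ProjPlane :=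
  Projectivization.mk ℂ ![a, b, 1] (affineVec_ne_zero a b)

/-- The inclusion of the Euclidean plane in the complex projective plane. -/
def toProj (x : Plane) : ProjPlane := affinePoint (x 0 : ℂ) (x 1 : ℂ)

/-- The zero locus `V(F)` of a homogeneous polynomial `F` in the projective plane. -/
def projZeroLocus (F : MvPolynomial (Fin 3) ℂ) : Set ProjPlane :=
  {p | MvPolynomial.eval p.rep F = 0}

/-- Vanishing of a homogeneous polynomial at a point can be tested on any representative. -/
theorem mk_mem_projZeroLocus {F : MvPolynomial (Fin 3) ℂ} {n : ℕ} (hF : F.IsHomogeneous n)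
    (v : Fin 3 → ℂ) (hv : v ≠ 0) :
    Projectivization.mk ℂ v hv ∈ projZeroLocus F ↔ MvPolynomial.eval v F = 0 := by
  obtain ⟨a, ha⟩ := Projectivization.exists_smul_eq_mk_rep ℂ v hv
  have h : MvPolynomial.eval ((a : ℂ) • v) F = (a : ℂ) ^ n * MvPolynomial.eval v F := by
    rw [MvPolynomial.eval_eq, MvPolynomial.eval_eq, Finset.mul_sum]
    refine Finset.sum_congr rfl fun s hs => ?_
    have hdeg : ∏ i ∈ s.support, (a : ℂ) ^ s i = (a : ℂ) ^ n := by
      rw [Finset.prod_pow_eq_pow_sum, ← hF (MvPolynomial.mem_support_iff.mp hs),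
        Finsupp.weight_apply]
      simp [Finsupp.sum]
    simp only [Pi.smul_apply, smul_eq_mul, mul_pow, Finset.prod_mul_distrib, hdeg]
    ring
  have ha' : (Projectivization.mk ℂ v hv).rep = (a : ℂ) • v := ha.symm
  simp only [projZeroLocus, Set.mem_ofPred_eq, ha', h]
  simp

/-- The Zariski closure of a subset of the complex projective plane. -/
def zariskiClosure (S : Set ProjPlane) : Set ProjPlane :=
  {p | ∀ (n : ℕ) (F : MvPolynomial (Fin 3) ℂ), F.IsHomogeneous n →
    S ⊆ projZeroLocus F → p ∈ projZeroLocus F}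

/-- The complex projective closure of a subset of the Euclidean plane. -/
def projClosure (S : Set Plane) : Set ProjPlane := zariskiClosure (toProj '' S)

/-- The line `z = 0` of ideal points of the affine plane. -/
def lineAtInfinity : Set ProjPlane := projZeroLocus (MvPolynomial.X 2)

/-- The ideal points of a subset of the Euclidean plane: the points of its complex projective
closure that lie on the line at infinity. -/
def idealPoints (S : Set Plane) : Set ProjPlane := projClosure S ∩ lineAtInfinity

/-- `C` is an irreducible algebraic curve of degree `d` in the complex projective plane. -/
def IsIrredCurveOfDegree (C : Set ProjPlane) (d : ℕ) : Prop :=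
  ∃ F : MvPolynomial (Fin 3) ℂ, F.IsHomogeneous d ∧ Irreducible F ∧ C = projZeroLocus F

/-- The part of `C` in the affine plane `z ≠ 0`. -/
def affinePart (C : Set ProjPlane) : Set (Fin 2 → ℂ) := {v | affinePoint (v 0) (v 1) ∈ C}

/-- The function field of `C` (an irreducible curve other than the line at infinity): the field of
fractions of the coordinate ring of its affine part. -/
abbrev FunctionField (C : Set ProjPlane) : Type :=
  FractionRing (MvPolynomial (Fin 2) ℂ ⧸ MvPolynomial.vanishingIdeal ℂ (affinePart C))

/-- `C` is a rational curve, that is, birational to the projective line: its function field is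
isomorphic over `ℂ` to the field of rational functions in one variable. -/
def IsRationalCurve (C : Set ProjPlane) : Prop :=
  Nonempty (FunctionField C ≃ₐ[ℂ] RatFunc ℂ)

theorem cyclicVec_ne_zero (w : ℂ) : (![1, w, 0] : Fin 3 → ℂ) ≠ 0 := fun h => by
  simpa using congrFun h 0

/-- The two cyclic points `(1 : i : 0)` and `(1 : -i : 0)`. -/
def cyclicPoints : Set ProjPlane :=
  {Projectivization.mk ℂ ![1, Complex.I, 0] (cyclicVec_ne_zero Complex.I),
    Projectivization.mk ℂ ![1, -Complex.I, 0] (cyclicVec_ne_zero (-Complex.I))}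

/-- `S` is parametrized by the three binary forms `P 0`, `P 1`, `P 2` of degree `d`, which have no
common complex zero other than the origin: `S` consists of the points
`(P 0 (μ) / P 2 (μ), P 1 (μ) / P 2 (μ))` for the real pairs `μ` with `P 2 (μ) ≠ 0`. -/
def IsParametrizedBy (S : Set Plane) (d : ℕ) (P : Fin 3 → MvPolynomial (Fin 2) ℝ) : Prop :=
  (∀ i, (P i).IsHomogeneous d) ∧
  (∀ μ : Fin 2 → ℂ, μ ≠ 0 → ∃ i, MvPolynomial.aeval μ (P i) ≠ 0) ∧
  S = {x | ∃ μ : Fin 2 → ℝ, MvPolynomial.eval μ (P 2) ≠ 0 ∧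
    x 0 = MvPolynomial.eval μ (P 0) / MvPolynomial.eval μ (P 2) ∧
    x 1 = MvPolynomial.eval μ (P 1) / MvPolynomial.eval μ (P 2)}

end TDOA

end

/-!
Identify the plane with `ℂ` so that `m₀ = 0`, `m₁ = d`, `m₂ = e`. The equation of the ellipse says
that `τ₁ = ⟨k, d⟩` and `τ₂ = ⟨k, e⟩` for a unit vector `k`. So `x` lies on the bifurcation curve if
and only if, for some unit vector `k` and with `ρ = ‖x‖`, the distances from `x` to `d` and `e` are
`ρ + ⟨k, d⟩` and `ρ + ⟨k, e⟩`. Squaring gives linear equations for `x + ρ k`, which is therefore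
quadratic in `k`, and then `‖x‖² = ρ²` is linear in `ρ`. With `r` and `s` proportional to `k ∧ d`
and `k ∧ e`, `p = r e - s d` and `q = r² e - s² d`, the result is

  `x = p̄ q² / (4 |p|² r s (r - s))`,

a parametrization by binary quintic forms in `(r, s)`. Conversely, for a point given by this formula
the distances are `ρ + ⟨k, m_i⟩` up to signs, and the signs agree: opposite signs at `m_i` and `m_j`
would force `k` to be parallel to `m_i - m_j`, which makes the denominator vanish
(`phase_mul_nonneg`). This is `mem_bifurcationCurve_iff`.

Over `ℂ`, take the parameters `t = p` and `u = p̄` and the isotropic coordinates `x`, `x̄`. Up to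
scaling factors the curve becomes `(u Q² : t Q'² : t u (u Q - t Q'))` with binary quadratic forms
`Q` and `Q'` (`quinticPoint`, `isoCoord_complexForms`). For any `Q` and `Q'` there are two moving
lines, of degrees two and three in `(t, u)`, that follow this point, and their cross product is the point
up to sign (`mul_quinticPoint_comm`). Hence the resultant of the two moving lines, which has degree
five, vanishes exactly on the image of the parametrization (`resultantForm_moving_eq_zero_iff`).

* The real points of the parametrization are Zariski dense in the image, so the projective closure
  is the zero locus of the resultant (`projClosure_eq_projZeroLocus`).
* The ideal of the image is prime, so by the Nullstellensatz the resultant is a power of an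
  irreducible polynomial; its degree is the prime `5` and the image is not a line, so it is
  irreducible (`irreducible_of_zeros_eq_range`).
* The remainder of the moving cubic modulo the moving quadratic is a linear equation for `(t : u)`
  with coefficients in the function field, so the parameter is a rational function on the curve
  (`isRationalCurve_of_param`).
* The points at infinity belong to the five linear factors of `4 t u r s (r - s)`: `t` and `u` give
  the cyclic points, `r`, `s` and `r - s` the directions of `d`, `e` and `e - d`.
-/

noncomputable section

namespace TDOA

open MvPolynomial

/-! ### Binary forms and their resultant -/

/-- The binary quadratic form with coefficients `k`, leading coefficient in `t` first. -/
def quadForm {S : Type*} [CommRing S] (k : Fin 3 → S) (t u : S) : S :=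
  k 0 * t ^ 2 + k 1 * (t * u) + k 2 * u ^ 2

/-- The binary cubic form with coefficients `k`, leading coefficient in `t` first. -/
def cubicForm {S : Type*} [CommRing S] (k : Fin 4 → S) (t u : S) : S :=
  k 0 * t ^ 3 + k 1 * (t ^ 2 * u) + k 2 * (t * u ^ 2) + k 3 * u ^ 3

/-- The resultant of a binary quadratic form and a binary cubic form, that is, the expansion of
their Sylvester determinant. -/
def resultantForm {S : Type*} [CommRing S] (a : Fin 3 → S) (b : Fin 4 → S) : S :=
  b 0 ^ 2 * a 2 ^ 3 - b 0 * b 1 * a 2 ^ 2 * a 1 + b 0 * b 2 * a 2 * (a 1 ^ 2 - 2 * a 2 * a 0)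
    + b 0 * b 3 * (3 * a 2 * a 1 * a 0 - a 1 ^ 3) + b 1 ^ 2 * a 2 ^ 2 * a 0
    - b 1 * b 2 * a 2 * a 1 * a 0 + b 1 * b 3 * a 0 * (a 1 ^ 2 - 2 * a 2 * a 0)
    + b 2 ^ 2 * a 2 * a 0 ^ 2 - b 2 * b 3 * a 1 * a 0 ^ 2 + b 3 ^ 2 * a 0 ^ 3

/-- The coefficient of `t` in `a₀²` times the remainder of a cubic `b` modulo a
quadratic `a`, both dehomogenized by `u = 1`. -/
def remT {S : Type*} [CommRing S] (a : Fin 3 → S) (b : Fin 4 → S) : S :=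
  b 0 * (a 1 ^ 2 - a 2 * a 0) - b 1 * a 1 * a 0 + b 2 * a 0 ^ 2

/-- The constant coefficient of `a₀²` times the remainder of a cubic `b` modulo a
quadratic `a`, both dehomogenized by `u = 1`. -/
def remU {S : Type*} [CommRing S] (a : Fin 3 → S) (b : Fin 4 → S) : S :=
  b 0 * a 2 * a 1 - b 1 * a 2 * a 0 + b 3 * a 0 ^ 2

theorem remT_mul_add_remU_mul {K : Type*} [Field K] {a : Fin 3 → K} {b : Fin 4 → K} {t u : K}
    (ha : quadForm a t u = 0) (hb : cubicForm b t u = 0) (hu : u ≠ 0) :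
    remT a b * t + remU a b * u = 0 := by
  have h : u ^ 2 * (remT a b * t + remU a b * u) = 0 := by
    simp only [quadForm, cubicForm, remT, remU] at *
    linear_combination (a 0 ^ 2) * hb - (a 0 * b 0 * t + (a 0 * b 1 - a 1 * b 0) * u) * ha
  exact (mul_eq_zero.mp h).resolve_left (pow_ne_zero 2 hu)

theorem exists_linear_factors {K : Type*} [Field K] [IsAlgClosed K] {k : Fin 3 → K} (hk : k ≠ 0) :
    ∃ p q p' q' : K, (p ≠ 0 ∨ q ≠ 0) ∧ (p' ≠ 0 ∨ q' ≠ 0) ∧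
      k 0 = q * q' ∧ k 1 = -(p * q' + p' * q) ∧ k 2 = p * p' := by
  by_cases h0 : k 0 = 0
  · by_cases h1 : k 1 = 0
    · refine ⟨k 2, 0, 1, 0, Or.inl fun h2 => hk ?_, by simp, by simp [h0], by simp [h1], by simp⟩
      ext i
      fin_cases i <;> simp [h0, h1, h2]
    · exact ⟨1, 0, k 2, -k 1, by simp, by simp [h1], by simp [h0], by simp, by simp⟩
  · obtain ⟨x, hx⟩ := IsAlgClosed.exists_root
      (Polynomial.C (k 0) * Polynomial.X ^ 2 + Polynomial.C (k 1) * Polynomial.X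
        + Polynomial.C (k 2)) (by rw [Polynomial.degree_quadratic h0]; decide)
    simp only [Polynomial.IsRoot, Polynomial.eval_add, Polynomial.eval_mul, Polynomial.eval_pow,
      Polynomial.eval_C, Polynomial.eval_X] at hx
    refine ⟨x, 1, -k 1 - k 0 * x, k 0, by simp, by simp [h0], by ring, by ring, ?_⟩
    linear_combination hx

theorem exists_cubicForm_eq_zero {K : Type*} [Field K] [IsAlgClosed K] (b : Fin 4 → K) :
    ∃ t u : K, (t ≠ 0 ∨ u ≠ 0) ∧ cubicForm b t u = 0 := by
  by_cases h0 : b 0 = 0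
  · exact ⟨1, 0, by simp, by simp [cubicForm, h0]⟩
  · obtain ⟨x, hx⟩ := IsAlgClosed.exists_root
      (Polynomial.C (b 0) * Polynomial.X ^ 3 + Polynomial.C (b 1) * Polynomial.X ^ 2
        + Polynomial.C (b 2) * Polynomial.X + Polynomial.C (b 3))
      (by rw [Polynomial.degree_cubic h0]; decide)
    simp only [Polynomial.IsRoot, Polynomial.eval_add, Polynomial.eval_mul, Polynomial.eval_pow,
      Polynomial.eval_C, Polynomial.eval_X] at hx
    exact ⟨x, 1, by simp, by simp only [cubicForm]; linear_combination hx⟩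

theorem resultantForm_eq_zero_iff {K : Type*} [Field K] [IsAlgClosed K] (a : Fin 3 → K)
    (b : Fin 4 → K) : resultantForm a b = 0 ↔
      ∃ t u : K, (t ≠ 0 ∨ u ≠ 0) ∧ quadForm a t u = 0 ∧ cubicForm b t u = 0 := by
  constructor
  · intro h
    by_cases ha : a = 0
    · obtain ⟨t, u, h1, h2⟩ := exists_cubicForm_eq_zero b
      exact ⟨t, u, h1, by simp [quadForm, ha], h2⟩
    -- The resultant is the product of the values of the cubic at the two zeros of the quadratic.
    obtain ⟨p, q, p', q', h1, h2, e0, e1, e2⟩ := exists_linear_factors ha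
    have hprod : cubicForm b p q * cubicForm b p' q' = 0 := by
      rw [← h]
      simp only [cubicForm, resultantForm, e0, e1, e2]
      ring
    rcases mul_eq_zero.mp hprod with hz | hz
    · exact ⟨p, q, h1, by simp only [quadForm, e0, e1, e2]; ring, hz⟩
    · exact ⟨p', q', h2, by simp only [quadForm, e0, e1, e2]; ring, hz⟩
  · rintro ⟨t, u, h, ha, hb⟩
    simp only [quadForm, cubicForm] at ha hb
    by_cases hu : u = 0
    · have ht : t ≠ 0 := h.resolve_right (by simp [hu])
      have ha0 : a 0 = 0 := by simpa [hu, ht] using ha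
      have hb0 : b 0 = 0 := by simpa [hu, ht] using hb
      simp [resultantForm, ha0, hb0]
    · have ea : a 2 = -(a 0 * (t / u) ^ 2 + a 1 * (t / u)) := by
        field_simp
        linear_combination ha
      have eb : b 3 = -(b 0 * (t / u) ^ 3 + b 1 * (t / u) ^ 2 + b 2 * (t / u)) := by
        field_simp
        linear_combination hb
      simp only [resultantForm, ea, eb]
      ring

/-! ### Implicitization by moving lines -/

/-- The point `(u Q², t Q'², t u (u Q - t Q'))`, where `Q` and `Q'` are the values at `(t, u)` of
the quadratic forms with coefficients `k` and `k'`. -/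
def quinticPoint {S : Type*} [CommRing S] (k k' : Fin 3 → S) (t u : S) : Fin 3 → S :=
  ![u * quadForm k t u ^ 2, t * quadForm k' t u ^ 2,
    t * u * (u * quadForm k t u - t * quadForm k' t u)]

/-- The moving line of degree two that follows `quinticPoint k k'`: the coefficients of the binary
quadratic form, linear in `v`, that vanishes at `(t, u)` if `v = quinticPoint k k' t u`. -/
def movingQuad {S : Type*} [CommRing S] (k k' v : Fin 3 → S) : Fin 3 → S :=
  ![-k' 0 * v 0 - (k 0 ^ 2 - k' 0 * (k 1 - k' 2)) * v 2,
    (k 0 - k' 1) * v 0 + (k 1 - k' 2) * v 1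
      - (2 * k 0 * k 1 - k 2 * k' 0 - (k 1 - k' 2) * (k 0 + k' 1)) * v 2,
    k 2 * v 1 - (k 0 * k 2 - k 2 * k' 1 + k' 2 ^ 2) * v 2]

/-- The moving line of degree three that follows `quinticPoint k k'`: the coefficients of the binary
cubic form, linear in `v`, that vanishes at `(t, u)` if `v = quinticPoint k k' t u`. -/
def movingCubic {S : Type*} [CommRing S] (k k' v : Fin 3 → S) : Fin 4 → S :=
  ![-k' 0 * v 2, -v 1 - (k 0 + k' 1) * v 2, v 0 - (k 1 + k' 2) * v 2, -k 2 * v 2]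

section

variable {S : Type*} [CommRing S] (k k' v : Fin 3 → S) (t u : S)

theorem quadForm_movingQuad_quinticPoint :
    quadForm (movingQuad k k' (quinticPoint k k' t u)) t u = 0 := by
  simp [quadForm, movingQuad, quinticPoint]
  ring

theorem cubicForm_movingCubic_quinticPoint :
    cubicForm (movingCubic k k' (quinticPoint k k' t u)) t u = 0 := by
  simp [quadForm, cubicForm, movingCubic, quinticPoint]
  ring

/-- The cross product of the two moving lines at `(t, u)` is `-quinticPoint k k' t u`; so a point on
both of them is proportional to `quinticPoint k k' t u`. -/
theorem mul_quinticPoint_comm (h2 : quadForm (movingQuad k k' v) t u = 0)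
    (h3 : cubicForm (movingCubic k k' v) t u = 0) (i j : Fin 3) :
    v i * quinticPoint k k' t u j = v j * quinticPoint k k' t u i := by
  simp [quadForm, cubicForm, movingQuad, movingCubic] at h2 h3
  have h01 : v 0 * quinticPoint k k' t u 1 = v 1 * quinticPoint k k' t u 0 := by
    simp [quinticPoint, quadForm]
    linear_combination
      ((k 0 ^ 2 - k' 0 * (k 1 - k' 2)) * t ^ 2
        + (2 * k 0 * k 1 - k 2 * k' 0 - (k 1 - k' 2) * (k 0 + k' 1)) * (t * u)
        + (k 0 * k 2 - k 2 * k' 1 + k' 2 ^ 2) * u ^ 2) * h3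
      - (u * (k 0 * t ^ 2 + k 1 * (t * u) + k 2 * u ^ 2)
        + t * (k' 0 * t ^ 2 + k' 1 * (t * u) + k' 2 * u ^ 2)) * h2
  have h02 : v 0 * quinticPoint k k' t u 2 = v 2 * quinticPoint k k' t u 0 := by
    simp [quinticPoint, quadForm]
    linear_combination (t^2*u) * h2 + (u * ((k 1 - k' 2) * t + k 2 * u)) * h3
  have h12 : v 1 * quinticPoint k k' t u 2 = v 2 * quinticPoint k k' t u 1 := by
    simp [quinticPoint, quadForm]
    linear_combination (t*u^2) * h2 - (t * (-k' 0 * t + (k 0 - k' 1) * u)) * h3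
  fin_cases i <;> fin_cases j <;> first | rfl | assumption | (symm; assumption)

end

theorem resultantForm_moving_eq_zero_iff {K : Type*} [Field K] [IsAlgClosed K] {k k' : Fin 3 → K}
    (hbase : ∀ t u, quinticPoint k k' t u = 0 → t = 0 ∧ u = 0) (v : Fin 3 → K) :
    resultantForm (movingQuad k k' v) (movingCubic k k' v) = 0 ↔
      ∃ t u, v = quinticPoint k k' t u := by
  rw [resultantForm_eq_zero_iff]
  constructor
  · rintro ⟨t, u, htu, h2, h3⟩
    have hne : quinticPoint k k' t u ≠ 0 := fun h => by
      obtain ⟨rfl, rfl⟩ := hbase t u h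
      simp at htu
    obtain ⟨j, hj⟩ := Function.ne_iff.mp hne
    -- The factor of proportionality is absorbed in the parameters, by homogeneity of degree five.
    obtain ⟨e, he⟩ := IsAlgClosed.exists_pow_nat_eq (v j / quinticPoint k k' t u j)
      (n := 5) (by norm_num)
    refine ⟨e * t, e * u, ?_⟩
    have hscale : quinticPoint k k' (e * t) (e * u) = e ^ 5 • quinticPoint k k' t u := by
      ext i
      fin_cases i <;> simp [quinticPoint, quadForm] <;> ring
    rw [hscale, he]
    ext i
    have := mul_quinticPoint_comm k k' v t u h2 h3 i j
    rw [Pi.smul_apply, smul_eq_mul, div_mul_eq_mul_div, eq_div_iff hj, this]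
  · rintro ⟨t, u, rfl⟩
    by_cases htu : t ≠ 0 ∨ u ≠ 0
    · exact ⟨t, u, htu, quadForm_movingQuad_quinticPoint k k' t u,
        cubicForm_movingCubic_quinticPoint k k' t u⟩
    · push Not at htu
      obtain ⟨rfl, rfl⟩ := htu
      refine ⟨1, 1, by simp, ?_, ?_⟩ <;>
        simp [quinticPoint, quadForm, cubicForm, movingQuad, movingCubic]

/-! ### Irreducibility of the equation of a parametrized hypersurface -/

theorem eval_aeval {σ τ K : Type*} [CommRing K] (f : σ → MvPolynomial τ K) (G : MvPolynomial σ K)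
    (μ : τ → K) : eval μ (aeval f G) = eval (fun i => eval μ (f i)) G := by
  have h : (eval μ).comp (aeval f : MvPolynomial σ K →ₐ[K] MvPolynomial τ K).toRingHom
      = eval fun i => eval μ (f i) := by
    ext <;> simp
  exact RingHom.congr_fun h G

theorem eval_add_of_totalDegree_le_one {σ R : Type*} [CommRing R] {H : MvPolynomial σ R}
    (hH : H.totalDegree ≤ 1) (x y : σ → R) :
    eval (x + y) H + eval 0 H = eval x H + eval y H := by
  have key : ∀ G ∈ homogeneousSubmodule σ R 1, eval (x + y) G + eval 0 G = eval x G + eval y G := by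
    intro G hG
    rw [homogeneousSubmodule_one_eq_span_X] at hG
    induction hG using Submodule.span_induction with
    | mem G h =>
      obtain ⟨i, rfl⟩ := h
      simp
    | zero => simp
    | add G G' _ _ h h' =>
      simp only [map_add]
      linear_combination h + h'
    | smul a G _ h =>
      simp only [smul_eval]
      linear_combination a * h
  have hsum : H = C (coeff 0 H) + homogeneousComponent 1 H := by
    conv_lhs => rw [← sum_homogeneousComponent H]
    rw [← homogeneousComponent_zero]
    rcases Nat.le_one_iff_eq_zero_or_eq_one.mp hH with h | h
    · rw [h, homogeneousComponent_eq_zero 1 H (by omega)]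
      simp
    · rw [h]
      simp [Finset.sum_range_succ]
  have := key _ (homogeneousComponent_mem 1 H)
  rw [hsum]
  simp only [map_add, eval_C]
  linear_combination this

/-- The zeros of `F` form the image of a polynomial map, so the ideal of polynomials that vanish on
them is prime, and `F` is a power of an irreducible polynomial. If the degree of `F` is prime,
either `F` is irreducible or its zeros are those of a polynomial of degree one; two zeros whose
sum is not a zero exclude the latter. -/
theorem irreducible_of_zeros_eq_range {σ τ K : Type*} [Field K] [IsAlgClosed K] [Finite σ]
    {d : ℕ} (hd : d.Prime) {F : MvPolynomial σ K} (hF : F.IsHomogeneous d)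
    (f : σ → MvPolynomial τ K)
    (hf : ∀ v, eval v F = 0 ↔ ∃ μ, v = fun i => eval μ (f i)) {x y : σ → K}
    (hx : eval x F = 0) (hy : eval y F = 0) (hxy : eval (x + y) F ≠ 0) : Irreducible F := by
  have hF0 : F ≠ 0 := by
    rintro rfl
    simp at hxy
  have hker : ∀ G, aeval f G = 0 ↔ ∀ v, eval v F = 0 → eval v G = 0 := by
    intro G
    constructor
    · intro h v hv
      obtain ⟨μ, rfl⟩ := (hf v).mp hv
      rw [← eval_aeval, h, map_zero]
    · intro h
      refine MvPolynomial.funext fun μ => ?_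
      rw [eval_aeval, map_zero]
      exact h _ ((hf _).mpr ⟨μ, rfl⟩)
  have hrad : ∀ G, aeval f G = 0 → ∃ n, F ∣ G ^ n := by
    intro G hG
    have : G ∈ vanishingIdeal K (zeroLocus K (Ideal.span {F})) := by
      intro v hv
      rw [← coe_aeval_eq_eval] at *
      refine (hker G).mp hG v ?_
      exact hv F (Ideal.mem_span_singleton_self F)
    rw [vanishingIdeal_zeroLocus_eq_radical] at this
    obtain ⟨n, hn⟩ := this
    exact ⟨n, Ideal.mem_span_singleton.mp hn⟩
  -- An irreducible factor of `F` in the kernel of the parametrization.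
  obtain ⟨H, hH, hHf⟩ : ∃ H, Irreducible H ∧ aeval f H = 0 := by
    have hFf : aeval f F = 0 := (hker F).mpr fun _ h => h
    obtain ⟨s, hs, u, hu⟩ := UniqueFactorizationMonoid.exists_prime_factors F hF0
    rw [← hu, map_mul, map_multiset_prod] at hFf
    rcases mul_eq_zero.mp hFf with h | h
    · rw [Multiset.prod_eq_zero_iff, Multiset.mem_map] at h
      obtain ⟨H, hHs, hH0⟩ := h
      exact ⟨H, (hs H hHs).irreducible, hH0⟩
    · exact absurd h ((u.isUnit.map (aeval f)).ne_zero)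
  obtain ⟨n, hn⟩ := hrad H hHf
  obtain ⟨i, -, hi⟩ := (dvd_prime_pow hH.prime n).mp hn
  obtain ⟨w, hw⟩ := hi
  have hwdeg : (w : MvPolynomial σ K).totalDegree = 0 := by
    have h1 := congrArg totalDegree (w.mul_inv)
    rw [totalDegree_mul_of_isDomain w.ne_zero w⁻¹.ne_zero, totalDegree_one] at h1
    omega
  have hdeg : ∀ j, (H ^ j).totalDegree = j * H.totalDegree := by
    intro j
    induction j with
    | zero => simp
    | succ j ih =>
      rw [pow_succ, totalDegree_mul_of_isDomain (pow_ne_zero _ hH.ne_zero) hH.ne_zero, ih]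
      ring
  have hdi : d = i * H.totalDegree := by
    rw [← hdeg, ← hw, totalDegree_mul_of_isDomain hF0 w.ne_zero, hwdeg, hF.totalDegree hF0,
      add_zero]
  rcases (Nat.prime_mul_iff.mp (hdi ▸ hd)) with ⟨-, h1⟩ | ⟨-, h1⟩
  · exfalso
    have hzero : ∀ v, eval v F = 0 → eval v H = 0 := (hker H).mp hHf
    have h0 : eval 0 F = 0 := by
      rw [eval_zero, constantCoeff_eq]
      exact hF.coeff_eq_zero (by simpa using hd.ne_zero.symm)
    have hadd := eval_add_of_totalDegree_le_one h1.le x y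
    rw [hzero x hx, hzero y hy, hzero 0 h0] at hadd
    have := congrArg (eval (x + y)) hw
    rw [map_mul, map_pow, show eval (x + y) H = 0 by simpa using hadd, zero_pow] at this
    · rcases mul_eq_zero.mp this with h | h
      · exact hxy h
      · exact (w.isUnit.map (eval (x + y))).ne_zero h
    · rintro rfl
      simp at hdi
      exact hd.ne_zero hdi
  · rw [h1, pow_one] at hw
    exact (Associated.irreducible_iff ⟨w, hw⟩).mpr hH

/-! ### Function fields of parametrized curves -/

/-- The point `(g₀ / g₂, g₁ / g₂)` of the affine plane at the parameter `θ`. -/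
def ratPoint (g : Fin 3 → Polynomial ℂ) (θ : ℂ) : Fin 2 → ℂ :=
  fun i => (g i.castSucc).eval θ / (g 2).eval θ

/-- Substitution of the rational functions `g₀ / g₂` and `g₁ / g₂` for the two variables. -/
def ratSubst (g : Fin 3 → Polynomial ℂ) : MvPolynomial (Fin 2) ℂ →ₐ[ℂ] RatFunc ℂ :=
  aeval fun i => algebraMap _ (RatFunc ℂ) (g i.castSucc) / algebraMap _ (RatFunc ℂ) (g 2)

section
variable {g : Fin 3 → Polynomial ℂ}

theorem exists_clear_denominators (hg : g 2 ≠ 0) (G : MvPolynomial (Fin 2) ℂ) :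
    ∃ (n : ℕ) (H : Polynomial ℂ),
      ratSubst g G * algebraMap _ (RatFunc ℂ) (g 2) ^ n = algebraMap _ (RatFunc ℂ) H ∧
      ∀ θ, (g 2).eval θ ≠ 0 → eval (ratPoint g θ) G * (g 2).eval θ ^ n = H.eval θ := by
  have hg' : algebraMap _ (RatFunc ℂ) (g 2) ≠ 0 := by simpa using hg
  induction G using MvPolynomial.induction_on with
  | C a => exact ⟨0, Polynomial.C a, by
    simp [ratSubst, RatFunc.algebraMap_C, RatFunc.algebraMap_eq_C], by simp⟩
  | add p q hp hq =>
    obtain ⟨n, H, h1, h2⟩ := hp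
    obtain ⟨n', H', h1', h2'⟩ := hq
    refine ⟨n + n', H * g 2 ^ n' + H' * g 2 ^ n, ?_, fun θ hθ => ?_⟩
    · simp only [map_add, map_mul, map_pow, ← h1, ← h1']
      ring
    · simp only [map_add, Polynomial.eval_add, Polynomial.eval_mul, Polynomial.eval_pow,
        ← h2 θ hθ, ← h2' θ hθ]
      ring
  | mul_X p i hp =>
    obtain ⟨n, H, h1, h2⟩ := hp
    refine ⟨n + 1, H * g i.castSucc, ?_, fun θ hθ => ?_⟩
    · simp only [map_mul, ← h1]
      simp only [ratSubst, aeval_X]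
      field_simp
      ring
    · simp only [map_mul, eval_X, Polynomial.eval_mul, ← h2 θ hθ, ratPoint]
      field_simp
      ring

theorem polynomial_eq_zero_of_forall_ne {p H : Polynomial ℂ} (hp : p ≠ 0)
    (h : ∀ θ, p.eval θ ≠ 0 → H.eval θ = 0) : H = 0 := by
  have : H * p = 0 := by
    refine Polynomial.funext fun θ => ?_
    by_cases hθ : p.eval θ = 0
    · simp [hθ]
    · simp [h θ hθ]
  exact (mul_eq_zero.mp this).resolve_right hp

theorem ratSubst_eq_zero_iff (hg : g 2 ≠ 0) (G : MvPolynomial (Fin 2) ℂ) :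
    ratSubst g G = 0 ↔ ∀ θ, (g 2).eval θ ≠ 0 → eval (ratPoint g θ) G = 0 := by
  have hg' : algebraMap _ (RatFunc ℂ) (g 2) ≠ 0 := by simpa using hg
  obtain ⟨n, H, h1, h2⟩ := exists_clear_denominators hg G
  constructor
  · intro h θ hθ
    have hH : H = 0 := by simpa [h] using h1.symm
    have := h2 θ hθ
    rw [hH, Polynomial.eval_zero] at this
    exact (mul_eq_zero.mp this).resolve_right (pow_ne_zero _ hθ)
  · intro h
    have hH : H = 0 := polynomial_eq_zero_of_forall_ne hg fun θ hθ => by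
      rw [← h2 θ hθ, h θ hθ, zero_mul]
    rw [hH, map_zero] at h1
    exact (mul_eq_zero.mp h1).resolve_right (pow_ne_zero _ hg')

/-- A parametrized curve is rational if the parameter is a rational function of the point. -/
theorem isRationalCurve_of_param {C : Set ProjPlane} (hg : g 2 ≠ 0)
    (hC : affinePart C = {v | ∃ θ, (g 2).eval θ ≠ 0 ∧ v = ratPoint g θ})
    (R S : MvPolynomial (Fin 2) ℂ)
    (hRS : ∀ θ, (g 2).eval θ ≠ 0 → eval (ratPoint g θ) R * θ + eval (ratPoint g θ) S = 0)
    (hR : ∃ θ, (g 2).eval θ ≠ 0 ∧ eval (ratPoint g θ) R ≠ 0) : IsRationalCurve C := by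
  have hg' : algebraMap _ (RatFunc ℂ) (g 2) ≠ 0 := by simpa using hg
  set I := vanishingIdeal ℂ (affinePart C) with hI
  have hker : ∀ G, G ∈ I ↔ ratSubst g G = 0 := by
    intro G
    rw [ratSubst_eq_zero_iff hg, hI, mem_vanishingIdeal_iff, hC]
    constructor
    · intro h θ hθ
      simpa [coe_aeval_eq_eval] using h _ ⟨θ, hθ, rfl⟩
    · rintro h v ⟨θ, hθ, rfl⟩
      simpa [coe_aeval_eq_eval] using h θ hθ
  have hIker : I = RingHom.ker (ratSubst g) := by
    ext G
    rw [hker, RingHom.mem_ker]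
  have : I.IsPrime := by
    rw [hIker]
    exact RingHom.ker_isPrime _
  let φ : (MvPolynomial (Fin 2) ℂ ⧸ I) →ₐ[ℂ] RatFunc ℂ :=
    Ideal.Quotient.liftₐ I (ratSubst g) fun G hG => (hker G).mp hG
  have hφ : Function.Injective φ := by
    rw [injective_iff_map_eq_zero]
    intro a ha
    obtain ⟨G, rfl⟩ := Ideal.Quotient.mk_surjective a
    exact Ideal.Quotient.eq_zero_iff_mem.mpr ((hker G).mpr ha)
  let Φ : FractionRing (MvPolynomial (Fin 2) ℂ ⧸ I) →ₐ[ℂ] RatFunc ℂ :=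
    IsFractionRing.liftAlgHom (g := φ) hφ
  have hΦ : ∀ G, Φ (algebraMap _ _ (Ideal.Quotient.mk I G)) = ratSubst g G := by
    intro G
    exact IsFractionRing.lift_algebraMap hφ _
  -- The range of `Φ` is a field that contains the parameter.
  have hX : ∃ a, Φ a = RatFunc.X := by
    refine ⟨-(algebraMap _ _ (Ideal.Quotient.mk I S)) / algebraMap _ _ (Ideal.Quotient.mk I R), ?_⟩
    have hR0 : ratSubst g R ≠ 0 := by
      rw [Ne, ratSubst_eq_zero_iff hg]
      push Not
      exact hR
    rw [map_div₀, map_neg, hΦ, hΦ, div_eq_iff hR0]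
    obtain ⟨n, H, h1, h2⟩ := exists_clear_denominators hg R
    obtain ⟨n', H', h1', h2'⟩ := exists_clear_denominators hg S
    have hH : H * Polynomial.X * g 2 ^ n' + H' * g 2 ^ n = 0 :=
      polynomial_eq_zero_of_forall_ne hg fun θ hθ => by
        simp only [Polynomial.eval_add, Polynomial.eval_mul, Polynomial.eval_pow, Polynomial.eval_X,
          ← h2 θ hθ, ← h2' θ hθ]
        linear_combination (g 2).eval θ ^ n * (g 2).eval θ ^ n' * hRS θ hθ
    have := congrArg (algebraMap _ (RatFunc ℂ)) hH
    simp only [map_add, map_mul, map_pow, map_zero, ← h1, ← h1', RatFunc.algebraMap_X] at this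
    refine mul_left_cancel₀ (mul_ne_zero (pow_ne_zero n hg') (pow_ne_zero n' hg')) ?_
    linear_combination -this
  have hpoly : ∀ p : Polynomial ℂ, ∃ a, Φ a = algebraMap _ (RatFunc ℂ) p := by
    obtain ⟨a, ha⟩ := hX
    intro p
    refine ⟨Polynomial.aeval a p, ?_⟩
    rw [← Polynomial.aeval_algHom_apply, ha, ← RatFunc.algebraMap_X,
      Polynomial.aeval_algebraMap_apply, Polynomial.aeval_X_left_apply]
  refine ⟨AlgEquiv.ofBijective Φ ⟨Φ.toRingHom.injective, fun x => ?_⟩⟩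
  obtain ⟨a, ha⟩ := hpoly x.num
  obtain ⟨b, hb⟩ := hpoly x.denom
  exact ⟨a / b, by rw [map_div₀, ha, hb, RatFunc.num_div_denom]⟩

end

/-! ### Projective closures -/

theorem toProj_mem_projZeroLocus {F : MvPolynomial (Fin 3) ℂ} {n : ℕ} (hF : F.IsHomogeneous n)
    (x : Plane) : toProj x ∈ projZeroLocus F ↔ eval ![(x 0 : ℂ), (x 1 : ℂ), 1] F = 0 :=
  mk_mem_projZeroLocus hF _ _

theorem eval_smul_eq_zero_iff {F : MvPolynomial (Fin 3) ℂ} {n : ℕ} (hF : F.IsHomogeneous n)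
    {c : ℂ} (hc : c ≠ 0) (v : Fin 3 → ℂ) : eval (c • v) F = 0 ↔ eval v F = 0 := by
  by_cases hv : v = 0
  · simp [hv]
  rw [← mk_mem_projZeroLocus hF (c • v) (smul_ne_zero hc hv), ← mk_mem_projZeroLocus hF v hv]
  have : Projectivization.mk ℂ (c • v) (smul_ne_zero hc hv) = Projectivization.mk ℂ v hv :=
    (Projectivization.mk_eq_mk_iff' ℂ _ _ _ _).mpr ⟨c, rfl⟩
  rw [this]

theorem mem_projZeroLocus_X_two (v : Fin 3 → ℂ) (hv : v ≠ 0) :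
    Projectivization.mk ℂ v hv ∈ lineAtInfinity ↔ v 2 = 0 := by
  rw [lineAtInfinity, mk_mem_projZeroLocus (isHomogeneous_X ℂ 2), eval_X]

theorem eq_zero_of_forall_real {τ : Type*} {p : MvPolynomial τ ℂ}
    (h : ∀ μ : τ → ℝ, eval (fun i => (μ i : ℂ)) p = 0) : p = 0 := by
  refine funext_set (fun _ => Set.range ((↑) : ℝ → ℂ))
    (fun _ => Set.infinite_range_of_injective Complex.ofReal_injective) fun x hx => ?_
  choose μ hμ using fun i => hx i (Set.mem_univ i)
  rw [map_zero, ← h μ]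
  congr 2
  exact funext fun i => (hμ i).symm

/-- A real parametrized set is Zariski dense in the complex curve with the same parametrization. -/
theorem projClosure_eq_projZeroLocus {S : Set Plane} {d n : ℕ} {P : Fin 3 → MvPolynomial (Fin 2) ℝ}
    (hS : IsParametrizedBy S d P) (hP : P 2 ≠ 0) {F : MvPolynomial (Fin 3) ℂ}
    (hF : F.IsHomogeneous n)
    (hFP : ∀ v, eval v F = 0 ↔ ∃ μ : Fin 2 → ℂ, v = fun i => aeval μ (P i)) :
    projClosure S = projZeroLocus F := by
  obtain ⟨-, -, hS⟩ := hS
  have hreal : ∀ (μ : Fin 2 → ℝ) i, aeval (fun i => (μ i : ℂ)) (P i) = ((eval μ (P i) : ℝ) : ℂ) :=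
    fun μ i => by
      have := aeval_algebraMap_apply ℂ μ (P i)
      simpa [coe_aeval_eq_eval, Function.comp_def] using this
  have hmem : ∀ (G : MvPolynomial (Fin 3) ℂ) (k : ℕ) (_ : G.IsHomogeneous k) (x : Plane)
      (μ : Fin 2 → ℝ), eval μ (P 2) ≠ 0 → x 0 = eval μ (P 0) / eval μ (P 2) →
      x 1 = eval μ (P 1) / eval μ (P 2) →
      (toProj x ∈ projZeroLocus G ↔ eval (fun i => aeval (fun i => (μ i : ℂ)) (P i)) G = 0) := by
    intro G k hG x μ h2 h0 h1
    have h2' : ((eval μ (P 2) : ℝ) : ℂ) ≠ 0 := by exact_mod_cast h2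
    rw [toProj_mem_projZeroLocus hG, ← eval_smul_eq_zero_iff hG h2']
    have hv : ((eval μ (P 2) : ℝ) : ℂ) • (![(x 0 : ℂ), (x 1 : ℂ), 1] : Fin 3 → ℂ)
        = fun i => aeval (fun i => (μ i : ℂ)) (P i) := by
      ext i
      rw [hreal]
      fin_cases i <;> simp [h0, h1] <;> field_simp
    rw [hv]
  apply Set.Subset.antisymm
  · intro p hp
    refine hp n F hF ?_
    rintro _ ⟨x, hx, rfl⟩
    rw [hS] at hx
    obtain ⟨μ, h2, h0, h1⟩ := hx
    rw [hmem F n hF x μ h2 h0 h1]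
    exact (hFP _).mpr ⟨_, rfl⟩
  · intro p hp k G hG hSG
    have hz : aeval (fun i => map (algebraMap ℝ ℂ) (P i)) G * map (algebraMap ℝ ℂ) (P 2) = 0 := by
      refine eq_zero_of_forall_real fun μ => ?_
      rw [map_mul, eval_aeval]
      simp only [eval_map, ← aeval_def]
      by_cases h2 : eval μ (P 2) = 0
      · rw [hreal, h2]
        simp
      · rw [(hmem G k hG !₂[eval μ (P 0) / eval μ (P 2), eval μ (P 1) / eval μ (P 2)] μ h2 (by simp)
          (by simp)).mp, zero_mul]
        refine hSG ⟨_, ?_, rfl⟩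
        rw [hS]
        exact ⟨μ, h2, by simp, by simp⟩
    have hP' : map (algebraMap ℝ ℂ) (P 2) ≠ 0 := by
      rwa [Ne, map_eq_zero_iff _ (map_injective _ (algebraMap ℝ ℂ).injective)]
    obtain ⟨μ, hμ⟩ := (hFP p.rep).mp hp
    have := congrArg (eval μ) ((mul_eq_zero.mp hz).resolve_right hP')
    rw [eval_aeval, map_zero] at this
    simp only [eval_map, ← aeval_def] at this
    show eval p.rep G = 0
    rw [hμ]
    exact this

theorem directionVec_ne_zero {a b : Plane} (hab : a ≠ b) :
    (![((b 0 - a 0 : ℝ) : ℂ), ((b 1 - a 1 : ℝ) : ℂ), 0] : Fin 3 → ℂ) ≠ 0 := fun h => by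
  apply hab
  have h0 := congrFun h 0
  have h1 := congrFun h 1
  simp only [Matrix.cons_val_zero, Matrix.cons_val_one, Pi.zero_apply, Complex.ofReal_eq_zero,
    sub_eq_zero] at h0 h1
  ext i
  fin_cases i
  · exact h0.symm
  · exact h1.symm

/-- A line has one ideal point, its direction. -/
theorem idealPoints_affineSpan_pair {a b : Plane} (hab : a ≠ b) :
    idealPoints (affineSpan ℝ {a, b}) = {Projectivization.mk ℂ _ (directionVec_ne_zero hab)} := by
  have hline : ∀ x : Plane, x ∈ (affineSpan ℝ {a, b} : Set Plane) ↔
      ∃ s : ℝ, ∀ i, x i = a i + s * (b i - a i) := by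
    intro x
    rw [SetLike.mem_coe, mem_affineSpan_pair_iff_exists_lineMap_eq]
    refine exists_congr fun s => ?_
    rw [AffineMap.lineMap_apply, PiLp.ext_iff]
    simp only [vsub_eq_sub, vadd_eq_add, PiLp.add_apply, PiLp.smul_apply, PiLp.sub_apply,
      smul_eq_mul]
    exact forall_congr' fun i => by rw [eq_comm, add_comm]
  apply Set.Subset.antisymm
  · rintro p ⟨hp, hp2⟩
    induction p using Projectivization.ind with
    | h v hv =>
      rw [mem_projZeroLocus_X_two] at hp2
      set F : MvPolynomial (Fin 3) ℂ :=
        C ((b 1 - a 1 : ℝ) : ℂ) * X 0 - C ((b 0 - a 0 : ℝ) : ℂ) * X 1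
        + C (((b 0 - a 0) * a 1 - (b 1 - a 1) * a 0 : ℝ) : ℂ) * X 2 with hFdef
      have hF : F.IsHomogeneous 1 :=
        ((isHomogeneous_C_mul_X _ _).sub (isHomogeneous_C_mul_X _ _)).add
          (isHomogeneous_C_mul_X _ _)
      have h := hp 1 F hF (by
        rintro _ ⟨x, hx, rfl⟩
        obtain ⟨s, hs⟩ := (hline x).mp hx
        rw [toProj_mem_projZeroLocus hF]
        simp [hFdef, hs]
        ring)
      rw [mk_mem_projZeroLocus hF] at h
      simp only [hFdef, map_add, map_sub, map_mul, eval_C, eval_X, hp2, mul_zero, add_zero] at h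
      rw [Set.mem_singleton_iff, Projectivization.mk_eq_mk_iff']
      have hd := directionVec_ne_zero hab
      by_cases h0 : ((b 0 - a 0 : ℝ) : ℂ) = 0
      · have h1 : ((b 1 - a 1 : ℝ) : ℂ) ≠ 0 := fun h1 => hd (by simp [h0, h1])
        refine ⟨v 1 / ((b 1 - a 1 : ℝ) : ℂ), ?_⟩
        have : v 0 = 0 := by
          rw [h0, zero_mul, sub_zero] at h
          exact (mul_eq_zero.mp h).resolve_left h1
        ext i
        fin_cases i
        · simp only [Pi.smul_apply, smul_eq_mul]; simp [h0, this]
        · exact div_mul_cancel₀ _ h1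
        · simp [hp2]
      · refine ⟨v 0 / ((b 0 - a 0 : ℝ) : ℂ), ?_⟩
        ext i
        fin_cases i
        · exact div_mul_cancel₀ _ h0
        · simp only [Pi.smul_apply, smul_eq_mul]
          show v 0 / _ * ((b 1 - a 1 : ℝ) : ℂ) = v 1
          rw [div_mul_eq_mul_div, div_eq_iff h0]
          linear_combination h
        · simp [hp2]
  · rintro _ rfl
    refine ⟨fun n G hG hSG => ?_, (mem_projZeroLocus_X_two _ _).mpr (by simp)⟩
    rw [mk_mem_projZeroLocus hG]
    -- The points of the line are `(ε a + (b - a) : ε)`; the direction is the value at `ε = 0`.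
    let f : Fin 3 → Polynomial ℂ :=
      ![Polynomial.C (a 0 : ℂ) * Polynomial.X + Polynomial.C ((b 0 - a 0 : ℝ) : ℂ),
        Polynomial.C (a 1 : ℂ) * Polynomial.X + Polynomial.C ((b 1 - a 1 : ℝ) : ℂ), Polynomial.X]
    have hev : ∀ ε : ℂ, (aeval f G).eval ε = eval (fun i => (f i).eval ε) G := by
      intro ε
      have h : (Polynomial.evalRingHom ε).comp
          (aeval f : MvPolynomial (Fin 3) ℂ →ₐ[ℂ] Polynomial ℂ).toRingHom
          = eval fun i => (f i).eval ε := by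
        ext <;> simp
      exact RingHom.congr_fun h G
    have hz : aeval f G = 0 := by
      refine Polynomial.eq_zero_of_infinite_isRoot _ (Set.Infinite.mono ?_
        ((Set.infinite_range_of_injective Complex.ofReal_injective).sdiff (Set.finite_singleton 0)))
      rintro _ ⟨⟨ε, rfl⟩, hε⟩
      have hε' : (ε : ℂ) ≠ 0 := hε
      show (aeval f G).eval (ε : ℂ) = 0
      rw [hev]
      have hx : (!₂[a 0 + ε⁻¹ * (b 0 - a 0), a 1 + ε⁻¹ * (b 1 - a 1)] : Plane) ∈
          (affineSpan ℝ {a, b} : Set Plane) := (hline _).mpr ⟨ε⁻¹, fun i => by fin_cases i <;> simp⟩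
      have := hSG ⟨_, hx, rfl⟩
      rw [toProj_mem_projZeroLocus hG, ← eval_smul_eq_zero_iff hG hε'] at this
      rw [← this]
      congr 2
      ext i
      fin_cases i <;> simp [f] <;> field_simp
    have := hev 0
    rw [hz, Polynomial.eval_zero] at this
    have hv : (![((b 0 - a 0 : ℝ) : ℂ), ((b 1 - a 1 : ℝ) : ℂ), 0] : Fin 3 → ℂ)
        = fun i => (f i).eval 0 := by
      ext i
      fin_cases i <;> simp [f]
    rw [hv, ← this]

/-! ### The real parametrization of the bifurcation curve -/

/-- The binary quintic forms that parametrize the bifurcation curve. Here `d` and `e` are the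
displacements `d₁₀` and `d₂₀`, and `o` is `m₀`. In complex notation, with `p = μ₀ e - μ₁ d` and
`q = μ₀² e - μ₁² d`, the third form is `4 |p|² μ₀ μ₁ (μ₀ - μ₁)` and the first two are the
coordinates of `p̄ q²`, translated by `o`. -/
def curveForms {S : Type*} [CommRing S] (d e o μ : Fin 2 → S) : Fin 3 → S :=
  let p : Fin 2 → S := fun i => μ 0 * e i - μ 1 * d i
  let q : Fin 2 → S := fun i => μ 0 ^ 2 * e i - μ 1 ^ 2 * d i
  let D : S := 4 * (p 0 ^ 2 + p 1 ^ 2) * (μ 0 * μ 1 * (μ 0 - μ 1))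
  ![p 0 * (q 0 ^ 2 - q 1 ^ 2) + p 1 * (2 * q 0 * q 1) + o 0 * D,
    p 0 * (2 * q 0 * q 1) - p 1 * (q 0 ^ 2 - q 1 ^ 2) + o 1 * D, D]

theorem norm_sq_eq (v : Plane) : ‖v‖ ^ 2 = v 0 ^ 2 + v 1 ^ 2 := by
  rw [EuclideanSpace.norm_sq_eq]
  simp

/-- A plane wave whose direction of propagation `p` is not that of `v - u` cannot have phases of
opposite signs at two points if their absolute values are the distances `|u|` and `|v|`. -/
theorem phase_mul_nonneg {A B N p₀ p₁ u₀ u₁ v₀ v₁ : ℝ} (hA : A ^ 2 = u₀ ^ 2 + u₁ ^ 2)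
    (hB : B ^ 2 = v₀ ^ 2 + v₁ ^ 2) (hN : N = p₀ ^ 2 + p₁ ^ 2)
    (h : N * (A - B) ^ 2 = (p₀ * (v₀ - u₀) + p₁ * (v₁ - u₁)) ^ 2)
    (hw : p₀ * (v₁ - u₁) - p₁ * (v₀ - u₀) ≠ 0) : 0 ≤ A * B := by
  by_contra hAB
  push Not at hAB
  have hw2 := pow_pos (abs_pos.mpr hw) 2
  rw [sq_abs] at hw2
  have h1 : 0 < N * ((v₀ - u₀) ^ 2 + (v₁ - u₁) ^ 2 - (A - B) ^ 2) := by
    have : N * ((v₀ - u₀) ^ 2 + (v₁ - u₁) ^ 2 - (A - B) ^ 2)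
        = (p₀ * (v₁ - u₁) - p₁ * (v₀ - u₀)) ^ 2 := by
      rw [mul_sub, h, hN]
      ring
    rw [this]
    exact hw2
  have hN0 : 0 ≤ N := by rw [hN]; positivity
  have h2 := pos_of_mul_pos_right h1 hN0
  have h3 : u₀ * v₀ + u₁ * v₁ < A * B := by nlinarith
  have h4 : (A * B) ^ 2 = (u₀ * v₀ + u₁ * v₁) ^ 2 + (u₀ * v₁ - u₁ * v₀) ^ 2 := by
    rw [mul_pow, hA, hB]
    ring
  nlinarith [sq_nonneg (u₀ * v₁ - u₁ * v₀)]

theorem exists_sign {A B C : ℝ} (hAB : 0 ≤ A * B) (hAC : 0 ≤ A * C) (hBC : 0 ≤ B * C) :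
    ∃ ε : ℝ, ε ^ 2 = 1 ∧ |A| = ε * A ∧ |B| = ε * B ∧ |C| = ε * C := by
  by_cases h : 0 ≤ A ∧ 0 ≤ B ∧ 0 ≤ C
  · exact ⟨1, by simp, by simp [h], by simp [h], by simp [h]⟩
  · have : A ≤ 0 ∧ B ≤ 0 ∧ C ≤ 0 := by
      by_contra h'
      simp only [not_and_or, not_le] at h h'
      rcases h with h | h | h <;> rcases h' with h' | h' | h' <;> nlinarith
    exact ⟨-1, by simp, by simp [abs_of_nonpos, this], by simp [abs_of_nonpos, this],
      by simp [abs_of_nonpos, this]⟩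

theorem curveForms_two {S : Type*} [CommRing S] (d e o μ : Fin 2 → S) :
    curveForms d e o μ 2 = 4 * ((μ 0 * e 0 - μ 1 * d 0) ^ 2 + (μ 0 * e 1 - μ 1 * d 1) ^ 2) *
      (μ 0 * μ 1 * (μ 0 - μ 1)) := rfl

/-- Let `(y₀, y₁)` be a point at the distances `ρ₀`, `ρ₁`, `ρ₂` from the origin, `(a, b)` and
`(c, e)`. If the differences of distances satisfy the equation of the ellipse, they are the inner
products of `(a, b)` and `(c, e)` with a unit vector `k`, and the point is `v - ρ₀ k` with `v` a
quadratic function of `k`. The equation `ρ₀² = |v - ρ₀ k|²` is then linear in `ρ₀`. -/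
theorem exists_param_of_distances {y₀ y₁ a b c e w ρ₀ ρ₁ ρ₂ : ℝ} (hw : w = a * e - b * c)
    (hm : w ≠ 0) (h0 : ρ₀ ^ 2 = y₀ ^ 2 + y₁ ^ 2) (h1 : ρ₁ ^ 2 = (y₀ - a) ^ 2 + (y₁ - b) ^ 2)
    (h2 : ρ₂ ^ 2 = (y₀ - c) ^ 2 + (y₁ - e) ^ 2)
    (hE : ((ρ₂ - ρ₀) * a - (ρ₁ - ρ₀) * c) ^ 2 + ((ρ₂ - ρ₀) * b - (ρ₁ - ρ₀) * e) ^ 2 = w ^ 2) :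
    ∃ μ : Fin 2 → ℝ, curveForms ![a, b] ![c, e] 0 μ 2 ≠ 0 ∧
      y₀ * curveForms ![a, b] ![c, e] 0 μ 2 = curveForms ![a, b] ![c, e] 0 μ 0 ∧
      y₁ * curveForms ![a, b] ![c, e] 0 μ 2 = curveForms ![a, b] ![c, e] 0 μ 1 := by
  obtain ⟨n₀, hn₀⟩ : ∃ n, n = (ρ₂ - ρ₀) * a - (ρ₁ - ρ₀) * c := ⟨_, rfl⟩
  obtain ⟨n₁, hn₁⟩ : ∃ n, n = (ρ₂ - ρ₀) * b - (ρ₁ - ρ₀) * e := ⟨_, rfl⟩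
  have hn : n₀ ^ 2 + n₁ ^ 2 = w ^ 2 := by rw [hn₀, hn₁, hE]
  clear hE
  obtain ⟨r, hr⟩ : ∃ r, r = n₀ * a + n₁ * b := ⟨_, rfl⟩
  obtain ⟨s, hs⟩ : ∃ s, s = n₀ * c + n₁ * e := ⟨_, rfl⟩
  obtain ⟨q₀, hq₀⟩ : ∃ q, q = r ^ 2 * c - s ^ 2 * a := ⟨_, rfl⟩
  obtain ⟨q₁, hq₁⟩ : ∃ q, q = r ^ 2 * e - s ^ 2 * b := ⟨_, rfl⟩
  have hp₀ : r * c - s * a = -w * n₁ := by rw [hr, hs, hw]; ring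
  have hp₁ : r * e - s * b = w * n₀ := by rw [hr, hs, hw]; ring
  have hqn : q₀ * n₀ + q₁ * n₁ = r * s * (r - s) := by
    rw [hq₀, hq₁]
    linear_combination (-r ^ 2) * hs + s ^ 2 * hr
  have hτ₁ : w * (ρ₁ - ρ₀) = n₀ * b - n₁ * a := by rw [hn₀, hn₁, hw]; ring
  have hτ₂ : w * (ρ₂ - ρ₀) = n₀ * e - n₁ * c := by rw [hn₀, hn₁, hw]; ring
  have hk₁ : r ^ 2 = w ^ 2 * (2 * (y₀ * a + y₁ * b) + 2 * ρ₀ * (ρ₁ - ρ₀)) := by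
    have : r ^ 2 = w ^ 2 * (a ^ 2 + b ^ 2) - (w * (ρ₁ - ρ₀)) ^ 2 := by
      rw [hτ₁, hr, ← hn]; ring
    rw [this]
    linear_combination w ^ 2 * (h0 - h1)
  have hk₂ : s ^ 2 = w ^ 2 * (2 * (y₀ * c + y₁ * e) + 2 * ρ₀ * (ρ₂ - ρ₀)) := by
    have : s ^ 2 = w ^ 2 * (c ^ 2 + e ^ 2) - (w * (ρ₂ - ρ₀)) ^ 2 := by
      rw [hτ₂, hs, ← hn]; ring
    rw [this]
    linear_combination w ^ 2 * (h0 - h2)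
  have hX₀ : 2 * w ^ 3 * y₀ = q₁ + 2 * w ^ 2 * ρ₀ * n₁ := by
    rw [hq₁, hk₁, hk₂, hn₁, hw]; ring
  have hX₁ : 2 * w ^ 3 * y₁ = -q₀ - 2 * w ^ 2 * ρ₀ * n₀ := by
    rw [hq₀, hk₁, hk₂, hn₀, hw]; ring
  have hq : q₀ ^ 2 + q₁ ^ 2 = -4 * w ^ 2 * ρ₀ * (r * s * (r - s)) := by
    linear_combination (-4 * w ^ 6) * h0 - 4 * w ^ 4 * ρ₀ ^ 2 * hn - 4 * w ^ 2 * ρ₀ * hqn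
      - (2 * w ^ 3 * y₀ + q₁ + 2 * w ^ 2 * ρ₀ * n₁) * hX₀
      - (2 * w ^ 3 * y₁ - q₀ - 2 * w ^ 2 * ρ₀ * n₀) * hX₁
  have hD : r * s * (r - s) ≠ 0 := by
    intro h
    rw [h, mul_zero] at hq
    have e0 : q₀ = 0 := pow_eq_zero_iff two_ne_zero |>.mp
      (le_antisymm (by linarith only [hq, sq_nonneg q₁]) (sq_nonneg q₀))
    have e1 : q₁ = 0 := pow_eq_zero_iff two_ne_zero |>.mp
      (le_antisymm (by linarith only [hq, sq_nonneg q₀]) (sq_nonneg q₁))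
    rw [hq₀] at e0
    rw [hq₁] at e1
    have er : w * r ^ 2 = 0 := by linear_combination a * e1 - b * e0 + r ^ 2 * hw
    have es : w * s ^ 2 = 0 := by linear_combination c * e1 - e * e0 + s ^ 2 * hw
    have er' : r = 0 := by simpa [hm] using er
    have es' : s = 0 := by simpa [hm] using es
    rw [er', es'] at hp₀ hp₁
    have z0 : n₀ = 0 := by simpa [hm] using hp₁
    have z1 : n₁ = 0 := by simpa [hm] using hp₀
    rw [z0, z1] at hn
    apply hm
    simpa using hn.symm
  have hN : 4 * ((r * c - s * a) ^ 2 + (r * e - s * b) ^ 2) * (r * s * (r - s))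
      = 4 * w ^ 4 * (r * s * (r - s)) := by
    rw [hp₀, hp₁]
    linear_combination 4 * w ^ 2 * (r * s * (r - s)) * hn
  have hD' : 4 * w ^ 4 * (r * s * (r - s)) ≠ 0 :=
    mul_ne_zero (mul_ne_zero (by norm_num) (pow_ne_zero _ hm)) hD
  refine ⟨![r, s], ?_, ?_, ?_⟩
  · rw [curveForms_two]
    simp only [Matrix.cons_val_zero, Matrix.cons_val_one, hN]
    exact hD'
  · simp only [curveForms, Matrix.cons_val, Pi.zero_apply, zero_mul, add_zero, ← hq₀, ← hq₁, hp₀,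
      hp₁]
    linear_combination 2 * w * (r * s * (r - s)) * hX₀ + w * n₁ * hq - 2 * w * q₁ * hqn
      + 4 * y₀ * w ^ 2 * (r * s * (r - s)) * hn
  · simp only [curveForms, Matrix.cons_val, Pi.zero_apply, zero_mul, add_zero, ← hq₀, ← hq₁, hp₀,
      hp₁]
    linear_combination 2 * w * (r * s * (r - s)) * hX₁ - w * n₀ * hq + 2 * w * q₀ * hqn
      + 4 * y₁ * w ^ 2 * (r * s * (r - s)) * hn

/-- Let `(y₀, y₁)` be a point of the parametrized curve, `p` the vector of the parametrization and
`N = |p|²`. With a suitable `σ`, the numbers `σ`, `σ + ⟨p, d⟩`, `σ + ⟨p, e⟩` are, up to a common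
sign, `√N` times the distances of the point from the origin, `d` and `e`. -/
theorem exists_phases {y₀ y₁ a b c e w r s p₀ p₁ N : ℝ} (hw : w = a * e - b * c) (hm : w ≠ 0)
    (hp₀ : p₀ = r * c - s * a) (hp₁ : p₁ = r * e - s * b) (hN : N = p₀ ^ 2 + p₁ ^ 2)
    (hD : curveForms ![a, b] ![c, e] 0 ![r, s] 2 ≠ 0)
    (hX₀ : y₀ * curveForms ![a, b] ![c, e] 0 ![r, s] 2 = curveForms ![a, b] ![c, e] 0 ![r, s] 0)
    (hX₁ : y₁ * curveForms ![a, b] ![c, e] 0 ![r, s] 2 = curveForms ![a, b] ![c, e] 0 ![r, s] 1) :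
    0 < N ∧ ∃ σ : ℝ, N * (y₀ ^ 2 + y₁ ^ 2) = σ ^ 2 ∧
      N * ((y₀ - a) ^ 2 + (y₁ - b) ^ 2) = (σ + (p₀ * a + p₁ * b)) ^ 2 ∧
      N * ((y₀ - c) ^ 2 + (y₁ - e) ^ 2) = (σ + (p₀ * c + p₁ * e)) ^ 2 ∧
      0 ≤ σ * (σ + (p₀ * a + p₁ * b)) ∧ 0 ≤ σ * (σ + (p₀ * c + p₁ * e)) ∧
      0 ≤ (σ + (p₀ * a + p₁ * b)) * (σ + (p₀ * c + p₁ * e)) := by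
  obtain ⟨D, hDdef⟩ : ∃ D, D = r * s * (r - s) := ⟨_, rfl⟩
  obtain ⟨q₀, hq₀⟩ : ∃ q, q = r ^ 2 * c - s ^ 2 * a := ⟨_, rfl⟩
  obtain ⟨q₁, hq₁⟩ : ∃ q, q = r ^ 2 * e - s ^ 2 * b := ⟨_, rfl⟩
  simp only [curveForms, Matrix.cons_val, Pi.zero_apply, zero_mul, add_zero, ← hp₀, ← hp₁, ← hN,
    ← hDdef, ← hq₀, ← hq₁] at hD hX₀ hX₁
  have hD0 : D ≠ 0 := right_ne_zero_of_mul hD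
  have hN0 : N ≠ 0 := right_ne_zero_of_mul (left_ne_zero_of_mul hD)
  have hNpos : 0 < N := lt_of_le_of_ne (by rw [hN]; positivity) hN0.symm
  have hr : r ≠ 0 := fun h => hD0 (by rw [hDdef, h]; ring)
  have hs : s ≠ 0 := fun h => hD0 (by rw [hDdef, h]; ring)
  have hrs : r - s ≠ 0 := fun h => hD0 (by rw [hDdef, h]; ring)
  obtain ⟨σ, hσ⟩ : ∃ σ, σ * (4 * D) = -(q₀ ^ 2 + q₁ ^ 2) :=
    ⟨-(q₀ ^ 2 + q₁ ^ 2) / (4 * D), div_mul_cancel₀ _ (by simpa using hD0)⟩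
  have hx₀ : N * y₀ * (4 * D) = p₀ * (q₀ ^ 2 - q₁ ^ 2) + p₁ * (2 * q₀ * q₁) := by
    linear_combination hX₀
  have hx₁ : N * y₁ * (4 * D) = p₀ * (2 * q₀ * q₁) - p₁ * (q₀ ^ 2 - q₁ ^ 2) := by
    linear_combination hX₁
  have hA : N * (y₀ ^ 2 + y₁ ^ 2) = σ ^ 2 := by
    have h4 : N * (4 * D) ^ 2 ≠ 0 := by positivity
    refine mul_left_cancel₀ h4 ?_
    linear_combination (N * y₀ * (4 * D) + (p₀ * (q₀ ^ 2 - q₁ ^ 2) + p₁ * (2 * q₀ * q₁))) * hx₀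
      + (N * y₁ * (4 * D) + (p₀ * (2 * q₀ * q₁) - p₁ * (q₀ ^ 2 - q₁ ^ 2))) * hx₁
      - N * (σ * (4 * D) - (q₀ ^ 2 + q₁ ^ 2)) * hσ - (q₀ ^ 2 + q₁ ^ 2) ^ 2 * hN
  have hpa : p₀ * b - p₁ * a = -(r * w) := by rw [hp₀, hp₁, hw]; ring
  have hpc : p₀ * e - p₁ * c = -(s * w) := by rw [hp₀, hp₁, hw]; ring
  have hB : N * ((y₀ - a) ^ 2 + (y₁ - b) ^ 2) = (σ + (p₀ * a + p₁ * b)) ^ 2 := by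
    have key : -2 * (N * y₀ * a + N * y₁ * b) + (r * w) ^ 2 = 2 * σ * (p₀ * a + p₁ * b) := by
      have h4 : 4 * D ≠ 0 := by simpa using hD0
      refine mul_left_cancel₀ h4 ?_
      have : -2 * ((p₀ * (q₀ ^ 2 - q₁ ^ 2) + p₁ * (2 * q₀ * q₁)) * a
          + (p₀ * (2 * q₀ * q₁) - p₁ * (q₀ ^ 2 - q₁ ^ 2)) * b) + (r * w) ^ 2 * (4 * D)
          = -2 * (q₀ ^ 2 + q₁ ^ 2) * (p₀ * a + p₁ * b) := by
        rw [hq₀, hq₁, hp₀, hp₁, hDdef, hw]; ring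
      linear_combination this - 2 * a * hx₀ - 2 * b * hx₁ - 2 * (p₀ * a + p₁ * b) * hσ
    linear_combination hA + key + (a ^ 2 + b ^ 2) * hN + (p₀ * b - p₁ * a - r * w) * hpa
  have hC : N * ((y₀ - c) ^ 2 + (y₁ - e) ^ 2) = (σ + (p₀ * c + p₁ * e)) ^ 2 := by
    have key : -2 * (N * y₀ * c + N * y₁ * e) + (s * w) ^ 2 = 2 * σ * (p₀ * c + p₁ * e) := by
      have h4 : 4 * D ≠ 0 := by simpa using hD0
      refine mul_left_cancel₀ h4 ?_
      have : -2 * ((p₀ * (q₀ ^ 2 - q₁ ^ 2) + p₁ * (2 * q₀ * q₁)) * c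
          + (p₀ * (2 * q₀ * q₁) - p₁ * (q₀ ^ 2 - q₁ ^ 2)) * e) + (s * w) ^ 2 * (4 * D)
          = -2 * (q₀ ^ 2 + q₁ ^ 2) * (p₀ * c + p₁ * e) := by
        rw [hq₀, hq₁, hp₀, hp₁, hDdef, hw]; ring
      linear_combination this - 2 * c * hx₀ - 2 * e * hx₁ - 2 * (p₀ * c + p₁ * e) * hσ
    linear_combination hA + key + (c ^ 2 + e ^ 2) * hN + (p₀ * e - p₁ * c - s * w) * hpc
  -- `phase_mul_nonneg` applies to the phases divided by `√N`.
  obtain ⟨P, hP0, hP⟩ : ∃ P, 0 < P ∧ P ^ 2 = N :=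
    ⟨√N, Real.sqrt_pos.mpr hNpos, Real.sq_sqrt hNpos.le⟩
  have hdiv : ∀ {α z : ℝ}, N * z = α ^ 2 → (α / P) ^ 2 = z := by
    intro α z h
    rw [div_pow, hP, ← h]
    field_simp
  have hmul : ∀ {α β : ℝ}, 0 ≤ α / P * (β / P) → 0 ≤ α * β := by
    intro α β h
    rw [div_mul_div_comm] at h
    have := mul_nonneg h (mul_pos hP0 hP0).le
    rwa [div_mul_cancel₀ _ (mul_pos hP0 hP0).ne'] at this
  have hsub : ∀ {α β γ : ℝ}, (α - β) ^ 2 = γ ^ 2 → N * (α / P - β / P) ^ 2 = γ ^ 2 := by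
    intro α β γ h
    rw [← sub_div, div_pow, hP, h]
    field_simp
  refine ⟨hNpos, σ, hA, hB, hC, hmul ?_, hmul ?_, hmul ?_⟩
  · refine phase_mul_nonneg (hdiv hA) (hdiv hB) hN (hsub (by ring)) ?_
    rw [show p₀ * (y₁ - b - y₁) - p₁ * (y₀ - a - y₀) = r * w by linear_combination -hpa]
    exact mul_ne_zero hr hm
  · refine phase_mul_nonneg (hdiv hA) (hdiv hC) hN (hsub (by ring)) ?_
    rw [show p₀ * (y₁ - e - y₁) - p₁ * (y₀ - c - y₀) = s * w by linear_combination -hpc]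
    exact mul_ne_zero hs hm
  · refine phase_mul_nonneg (hdiv hB) (hdiv hC) hN (hsub (by ring)) ?_
    rw [show p₀ * (y₁ - e - (y₁ - b)) - p₁ * (y₀ - c - (y₀ - a)) = -((r - s) * w) by
      linear_combination hpa - hpc]
    exact neg_ne_zero.mpr (mul_ne_zero hrs hm)

/-- The distances of a point of the parametrized curve satisfy the equation of the ellipse. -/
theorem ellipse_of_param {y₀ y₁ a b c e w ρ₀ ρ₁ ρ₂ : ℝ} (hw : w = a * e - b * c) (hm : w ≠ 0)
    (h0 : ρ₀ ^ 2 = y₀ ^ 2 + y₁ ^ 2) (h1 : ρ₁ ^ 2 = (y₀ - a) ^ 2 + (y₁ - b) ^ 2)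
    (h2 : ρ₂ ^ 2 = (y₀ - c) ^ 2 + (y₁ - e) ^ 2) (p0 : 0 ≤ ρ₀) (p1 : 0 ≤ ρ₁) (p2 : 0 ≤ ρ₂)
    {r s : ℝ} (hD : curveForms ![a, b] ![c, e] 0 ![r, s] 2 ≠ 0)
    (hX₀ : y₀ * curveForms ![a, b] ![c, e] 0 ![r, s] 2 = curveForms ![a, b] ![c, e] 0 ![r, s] 0)
    (hX₁ : y₁ * curveForms ![a, b] ![c, e] 0 ![r, s] 2 = curveForms ![a, b] ![c, e] 0 ![r, s] 1) :
    ((ρ₂ - ρ₀) * a - (ρ₁ - ρ₀) * c) ^ 2 + ((ρ₂ - ρ₀) * b - (ρ₁ - ρ₀) * e) ^ 2 = w ^ 2 := by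
  obtain ⟨p₀, hp₀⟩ : ∃ p, p = r * c - s * a := ⟨_, rfl⟩
  obtain ⟨p₁, hp₁⟩ : ∃ p, p = r * e - s * b := ⟨_, rfl⟩
  obtain ⟨N, hN⟩ : ∃ N, N = p₀ ^ 2 + p₁ ^ 2 := ⟨_, rfl⟩
  obtain ⟨hNpos, σ, hA, hB, hC, hAB, hAC, hBC⟩ := exists_phases hw hm hp₀ hp₁ hN hD hX₀ hX₁
  obtain ⟨P, hP0, hP⟩ : ∃ P, 0 < P ∧ P ^ 2 = N :=
    ⟨√N, Real.sqrt_pos.mpr hNpos, Real.sq_sqrt hNpos.le⟩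
  have habs : ∀ {ρ z α : ℝ}, 0 ≤ ρ → ρ ^ 2 = z → N * z = α ^ 2 → P * ρ = |α| := by
    intro ρ z α hρ h h'
    rw [← abs_of_nonneg (mul_nonneg hP0.le hρ)]
    exact (sq_eq_sq_iff_abs_eq_abs _ _).mp (by rw [mul_pow, hP, h, h'])
  obtain ⟨ε, hε, e0, e1, e2⟩ := exists_sign hAB hAC hBC
  have r0 := (habs p0 h0 hA).trans e0
  have r1 := (habs p1 h1 hB).trans e1
  have r2 := (habs p2 h2 hC).trans e2
  have t1 : P * (ρ₁ - ρ₀) = ε * (p₀ * a + p₁ * b) := by linear_combination r1 - r0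
  have t2 : P * (ρ₂ - ρ₀) = ε * (p₀ * c + p₁ * e) := by linear_combination r2 - r0
  have n0 : P * ((ρ₂ - ρ₀) * a - (ρ₁ - ρ₀) * c) = ε * (w * p₁) := by
    rw [hw]; linear_combination a * t2 - c * t1
  have n1 : P * ((ρ₂ - ρ₀) * b - (ρ₁ - ρ₀) * e) = -(ε * (w * p₀)) := by
    rw [hw]; linear_combination b * t2 - e * t1
  refine mul_left_cancel₀ (pow_ne_zero 2 hP0.ne') ?_
  rw [mul_add, ← mul_pow, ← mul_pow, n0, n1]
  linear_combination (w ^ 2 * (p₀ ^ 2 + p₁ ^ 2)) * hε - w ^ 2 * hN - w ^ 2 * hP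

theorem curveForms_translate {S : Type*} [CommRing S] (d e o μ : Fin 2 → S) (i : Fin 2) :
    curveForms d e o μ i.castSucc
      = curveForms d e 0 μ i.castSucc + o i * curveForms d e 0 μ 2 := by
  fin_cases i <;> simp [curveForms]

theorem mem_bifurcationCurve_iff {m : Fin 3 → Plane} (hm : wedge (disp m 1 0) (disp m 2 0) ≠ 0)
    (x : Plane) : x ∈ bifurcationCurve m ↔ ∃ μ : Fin 2 → ℝ,
      curveForms (disp m 1 0) (disp m 2 0) (m 0) μ 2 ≠ 0 ∧ ∀ i : Fin 2, x i =
        curveForms (disp m 1 0) (disp m 2 0) (m 0) μ i.castSucc /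
          curveForms (disp m 1 0) (disp m 2 0) (m 0) μ 2 := by
  have hvec : ∀ v : Plane, (v : Fin 2 → ℝ) = ![v 0, v 1] := fun v => by
    ext i
    fin_cases i <;> rfl
  have h0 : ‖x - m 0‖ ^ 2 = (x 0 - m 0 0) ^ 2 + (x 1 - m 0 1) ^ 2 := norm_sq_eq _
  have h1 : ‖x - m 1‖ ^ 2 = (x 0 - m 0 0 - disp m 1 0 0) ^ 2
      + (x 1 - m 0 1 - disp m 1 0 1) ^ 2 := by
    rw [norm_sq_eq]
    simp only [disp, PiLp.sub_apply]
    ring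
  have h2 : ‖x - m 2‖ ^ 2 = (x 0 - m 0 0 - disp m 2 0 0) ^ 2
      + (x 1 - m 0 1 - disp m 2 0 1) ^ 2 := by
    rw [norm_sq_eq]
    simp only [disp, PiLp.sub_apply]
    ring
  have hE : x ∈ bifurcationCurve m ↔
      ((‖x - m 2‖ - ‖x - m 0‖) * disp m 1 0 0 - (‖x - m 1‖ - ‖x - m 0‖) * disp m 2 0 0) ^ 2
        + ((‖x - m 2‖ - ‖x - m 0‖) * disp m 1 0 1 - (‖x - m 1‖ - ‖x - m 0‖) * disp m 2 0 1) ^ 2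
      = wedge (disp m 1 0) (disp m 2 0) ^ 2 := by
    change aPoly m (tdoaMap m x) = 0 ↔ _
    rw [aPoly, norm_sq_eq, sub_eq_zero]
    simp only [tdoaMap, PiLp.sub_apply, PiLp.smul_apply, smul_eq_mul]
  have hform : ∀ μ : Fin 2 → ℝ,
      (curveForms (disp m 1 0) (disp m 2 0) (m 0) μ 2 ≠ 0 ∧ ∀ i : Fin 2, x i =
        curveForms (disp m 1 0) (disp m 2 0) (m 0) μ i.castSucc /
          curveForms (disp m 1 0) (disp m 2 0) (m 0) μ 2) ↔
      (curveForms ![disp m 1 0 0, disp m 1 0 1] ![disp m 2 0 0, disp m 2 0 1] 0 μ 2 ≠ 0 ∧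
        (x 0 - m 0 0) *
          curveForms ![disp m 1 0 0, disp m 1 0 1] ![disp m 2 0 0, disp m 2 0 1] 0 μ 2 =
          curveForms ![disp m 1 0 0, disp m 1 0 1] ![disp m 2 0 0, disp m 2 0 1] 0 μ 0 ∧
        (x 1 - m 0 1) *
          curveForms ![disp m 1 0 0, disp m 1 0 1] ![disp m 2 0 0, disp m 2 0 1] 0 μ 2 =
          curveForms ![disp m 1 0 0, disp m 1 0 1] ![disp m 2 0 0, disp m 2 0 1] 0 μ 1) := by
    intro μ
    rw [← hvec, ← hvec, show curveForms (disp m 1 0) (disp m 2 0) (m 0) μ 2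
      = curveForms (disp m 1 0) (disp m 2 0) 0 μ 2 from rfl]
    refine and_congr_right fun hD => ?_
    rw [Fin.forall_fin_two, curveForms_translate _ _ (m 0), curveForms_translate _ _ (m 0),
      eq_div_iff hD, eq_div_iff hD, sub_mul, sub_mul, sub_eq_iff_eq_add, sub_eq_iff_eq_add]
    rfl
  simp only [hform]
  rw [hE]
  constructor
  · exact exists_param_of_distances rfl hm h0 h1 h2
  · rintro ⟨μ, hD, hX₀, hX₁⟩
    have hμ : μ = ![μ 0, μ 1] := by
      ext i
      fin_cases i <;> rfl
    rw [hμ] at hD hX₀ hX₁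
    exact ellipse_of_param rfl hm h0 h1 h2 (norm_nonneg _) (norm_nonneg _) (norm_nonneg _) hD
      hX₀ hX₁

/-! ### The complexified curve -/

/-- The coordinates `(c₀ w, c₀ w', c₄ z)` of the vector `v = (x, y, z)`, where
`w = (x - c₂ z) + c₁ (y - c₃ z)` and `w' = (x - c₂ z) - c₁ (y - c₃ z)`. If `c₁` is the imaginary
unit and `(c₂, c₃)` is a real point, then `w` and `w'` are the isotropic coordinates centred at that
point. -/
def isoCoord {S : Type*} [CommRing S] (c : Fin 5 → S) (v : Fin 3 → S) : Fin 3 → S :=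
  ![c 0 * ((v 0 - c 2 * v 2) + c 1 * (v 1 - c 3 * v 2)),
    c 0 * ((v 0 - c 2 * v 2) - c 1 * (v 1 - c 3 * v 2)), c 4 * v 2]

/-- The equation at `v` of the curve whose points have the isotropic coordinates
`quinticPoint k k' t u`. -/
def implicitForm {S : Type*} [CommRing S] (k k' : Fin 3 → S) (c : Fin 5 → S) (v : Fin 3 → S) : S :=
  resultantForm (movingQuad k k' (isoCoord c v)) (movingCubic k k' (isoCoord c v))

/-- With `inverseU`, the coefficients of a linear equation for the parameters `(t : u)` of a
point `v` of the curve. -/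
def inverseT {S : Type*} [CommRing S] (k k' : Fin 3 → S) (c : Fin 5 → S) (v : Fin 3 → S) : S :=
  remT (movingQuad k k' (isoCoord c v)) (movingCubic k k' (isoCoord c v))

/-- With `inverseT`, the coefficients of a linear equation for the parameters `(t : u)` of a
point `v` of the curve. -/
def inverseU {S : Type*} [CommRing S] (k k' : Fin 3 → S) (c : Fin 5 → S) (v : Fin 3 → S) : S :=
  remU (movingQuad k k' (isoCoord c v)) (movingCubic k k' (isoCoord c v))

section
variable {R S : Type*} [CommRing R] [CommRing S] (φ : R →+* S)

theorem map_implicitForm (k k' : Fin 3 → R) (c : Fin 5 → R) (v : Fin 3 → R) :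
    φ (implicitForm k k' c v) = implicitForm (φ ∘ k) (φ ∘ k') (φ ∘ c) (φ ∘ v) := by
  simp [map_ofNat φ, implicitForm, resultantForm, movingQuad, movingCubic, isoCoord]

theorem map_inverseT (k k' : Fin 3 → R) (c : Fin 5 → R) (v : Fin 3 → R) :
    φ (inverseT k k' c v) = inverseT (φ ∘ k) (φ ∘ k') (φ ∘ c) (φ ∘ v) := by
  simp [map_ofNat φ, inverseT, remT, movingQuad, movingCubic, isoCoord]

theorem map_inverseU (k k' : Fin 3 → R) (c : Fin 5 → R) (v : Fin 3 → R) :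
    φ (inverseU k k' c v) = inverseU (φ ∘ k) (φ ∘ k') (φ ∘ c) (φ ∘ v) := by
  simp [map_ofNat φ, inverseU, remU, movingQuad, movingCubic, isoCoord]

theorem map_curveForms (d e o μ : Fin 2 → R) (i : Fin 3) :
    φ (curveForms d e o μ i) = curveForms (φ ∘ d) (φ ∘ e) (φ ∘ o) (φ ∘ μ) i := by
  fin_cases i <;> simp [map_ofNat φ, curveForms]

theorem inverseT_smul (k k' : Fin 3 → R) (c : Fin 5 → R) (x : R) (v : Fin 3 → R) :
    inverseT k k' c (x • v) = x ^ 3 * inverseT k k' c v := by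
  simp [inverseT, remT, movingQuad, movingCubic, isoCoord]
  ring

theorem curveForms_smul (d e o μ : Fin 2 → R) (x : R) :
    curveForms d e o (x • μ) = x ^ 5 • curveForms d e o μ := by
  ext i
  fin_cases i <;> simp [curveForms] <;> ring

end

theorem isHomogeneous_resultantForm {σ R : Type*} [CommRing R] {a : Fin 3 → MvPolynomial σ R}
    {b : Fin 4 → MvPolynomial σ R} (ha : ∀ i, (a i).IsHomogeneous 1)
    (hb : ∀ i, (b i).IsHomogeneous 1) : (resultantForm a b).IsHomogeneous 5 := by
  have h2 : (a 1 ^ 2 - 2 * a 2 * a 0).IsHomogeneous 2 :=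
    ((ha 1).pow 2).sub (((isHomogeneous_C σ (2 : R)).mul (ha 2)).mul (ha 0))
  have h3 : (3 * a 2 * a 1 * a 0 - a 1 ^ 3).IsHomogeneous 3 :=
    ((((isHomogeneous_C σ (3 : R)).mul (ha 2)).mul (ha 1)).mul (ha 0)).sub ((ha 1).pow 3)
  refine IsHomogeneous.add (IsHomogeneous.sub (IsHomogeneous.add (IsHomogeneous.add
    (IsHomogeneous.sub (IsHomogeneous.add (IsHomogeneous.add (IsHomogeneous.add
    (IsHomogeneous.sub ?_ ?_) ?_) ?_) ?_) ?_) ?_) ?_) ?_) ?_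
  · exact ((hb 0).pow 2).mul ((ha 2).pow 3)
  · exact (((hb 0).mul (hb 1)).mul ((ha 2).pow 2)).mul (ha 1)
  · exact (((hb 0).mul (hb 2)).mul (ha 2)).mul h2
  · exact ((hb 0).mul (hb 3)).mul h3
  · exact (((hb 1).pow 2).mul ((ha 2).pow 2)).mul (ha 0)
  · exact ((((hb 1).mul (hb 2)).mul (ha 2)).mul (ha 1)).mul (ha 0)
  · exact (((hb 1).mul (hb 3)).mul (ha 0)).mul h2
  · exact (((hb 2).pow 2).mul (ha 2)).mul ((ha 0).pow 2)
  · exact (((hb 2).mul (hb 3)).mul (ha 1)).mul ((ha 0).pow 2)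
  · exact ((hb 3).pow 2).mul ((ha 0).pow 3)

theorem isHomogeneous_implicitForm {R : Type*} [CommRing R] (k k' : Fin 3 → R) (c : Fin 5 → R) :
    (implicitForm (C ∘ k) (C ∘ k') (C ∘ c) X : MvPolynomial (Fin 3) R).IsHomogeneous 5 := by
  have hc : ∀ (x : R) {p : MvPolynomial (Fin 3) R}, p.IsHomogeneous 1 → (C x * p).IsHomogeneous 1 :=
    fun x p hp => hp.C_mul x
  have hX : ∀ i, (X i : MvPolynomial (Fin 3) R).IsHomogeneous 1 := isHomogeneous_X R
  have hl : ∀ i, (isoCoord (C ∘ c) X i : MvPolynomial (Fin 3) R).IsHomogeneous 1 := by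
    have h0 := (hX 0).sub (hc (c 2) (hX 2))
    have h1 := hc (c 1) ((hX 1).sub (hc (c 3) (hX 2)))
    intro i
    fin_cases i
    · exact hc (c 0) (h0.add h1)
    · exact hc (c 0) (h0.sub h1)
    · exact hc (c 4) (hX 2)
  refine isHomogeneous_resultantForm (fun i => ?_) (fun i => ?_)
  · fin_cases i
    · have := (hc (-k' 0) (hl 0)).sub (hc (k 0 ^ 2 - k' 0 * (k 1 - k' 2)) (hl 2))
      simpa [movingQuad] using this
    · have := ((hc (k 0 - k' 1) (hl 0)).add (hc (k 1 - k' 2) (hl 1))).sub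
        (hc (2 * k 0 * k 1 - k 2 * k' 0 - (k 1 - k' 2) * (k 0 + k' 1)) (hl 2))
      simpa [movingQuad, map_ofNat (C : R →+* MvPolynomial (Fin 3) R)] using this
    · have := (hc (k 2) (hl 1)).sub (hc (k 0 * k 2 - k 2 * k' 1 + k' 2 ^ 2) (hl 2))
      simpa [movingQuad] using this
  · fin_cases i
    · simpa [movingCubic] using hc (-k' 0) (hl 2)
    · have := (hl 1).neg.sub (hc (k 0 + k' 1) (hl 2))
      simpa [movingCubic] using this
    · have := (hl 0).sub (hc (k 1 + k' 2) (hl 2))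
      simpa [movingCubic] using this
    · simpa [movingCubic] using hc (-k 2) (hl 2)

theorem isHomogeneous_curveForms {R : Type*} [CommRing R] (d e o : Fin 2 → R) (i : Fin 3) :
    (curveForms (C ∘ d) (C ∘ e) (C ∘ o) X i : MvPolynomial (Fin 2) R).IsHomogeneous 5 := by
  have hX : ∀ i, (X i : MvPolynomial (Fin 2) R).IsHomogeneous 1 := isHomogeneous_X R
  have hp : ∀ i, (X 0 * C (e i) - X 1 * C (d i) : MvPolynomial (Fin 2) R).IsHomogeneous 1 :=
    fun i => ((hX 0).mul (isHomogeneous_C _ _)).sub ((hX 1).mul (isHomogeneous_C _ _))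
  have hq : ∀ i, (X 0 ^ 2 * C (e i) - X 1 ^ 2 * C (d i) : MvPolynomial (Fin 2) R).IsHomogeneous 2 :=
    fun i => (((hX 0).pow 2).mul (isHomogeneous_C _ _)).sub
      (((hX 1).pow 2).mul (isHomogeneous_C _ _))
  have hD : (curveForms (C ∘ d) (C ∘ e) (C ∘ o) X 2 : MvPolynomial (Fin 2) R).IsHomogeneous 5 :=
    ((isHomogeneous_C _ (4 : R)).mul (((hp 0).pow 2).add ((hp 1).pow 2))).mul
      (((hX 0).mul (hX 1)).mul ((hX 0).sub (hX 1)))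
  have h1 := ((hq 0).pow 2).sub ((hq 1).pow 2)
  have h2 := ((isHomogeneous_C _ (2 : R)).mul (hq 0)).mul (hq 1)
  fin_cases i
  · exact (((hp 0).mul h1).add ((hp 1).mul h2)).add ((isHomogeneous_C _ (o 0)).mul hD)
  · exact (((hp 0).mul h2).sub ((hp 1).mul h1)).add ((isHomogeneous_C _ (o 1)).mul hD)
  · exact hD

/-- The coefficients, in the parameters `t = A r + B s` and `u = A' r + B' s`, of the binary
quadratic form `(A B' - A' B)² (A r² + B s²)`. -/
def conicCoeff (A B A' B' : ℂ) : Fin 3 → ℂ :=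
  ![A * B' ^ 2 + B * A' ^ 2, -2 * A * B * (A' + B'), A * B * (A + B)]

/-- The coefficients, in the parameters `t = A r + B s` and `u = A' r + B' s`, of the binary
quadratic form `(A B' - A' B)² (A' r² + B' s²)`. -/
def conicCoeff' (A B A' B' : ℂ) : Fin 3 → ℂ :=
  ![A' * B' * (A' + B'), -2 * A' * B' * (A + B), A' * B ^ 2 + B' * A ^ 2]

section
variable {A B A' B' : ℂ}

theorem quadForm_conicCoeff (t u : ℂ) : quadForm (conicCoeff A B A' B') t u
    = A * (B' * t - B * u) ^ 2 + B * (A * u - A' * t) ^ 2 := by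
  simp [quadForm, conicCoeff]
  ring

theorem quadForm_conicCoeff' (t u : ℂ) : quadForm (conicCoeff' A B A' B') t u
    = A' * (B' * t - B * u) ^ 2 + B' * (A * u - A' * t) ^ 2 := by
  simp [quadForm, conicCoeff']
  ring

theorem conic_sub_eq (t u : ℂ) : u * quadForm (conicCoeff A B A' B') t u
      - t * quadForm (conicCoeff' A B A' B') t u
    = (A * u - A' * t) * (B' * t - B * u) * ((A' + B') * t - (A + B) * u) := by
  rw [quadForm_conicCoeff, quadForm_conicCoeff']
  ring

theorem quinticPoint_conicCoeff_eq_zero (hE : A * B' - A' * B ≠ 0) (hc : A * B * (A + B) ≠ 0)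
    (hc' : A' * B' * (A' + B') ≠ 0) (t u : ℂ)
    (h : quinticPoint (conicCoeff A B A' B') (conicCoeff' A B A' B') t u = 0) : t = 0 ∧ u = 0 := by
  have h0 := congrFun h 0
  have h1 := congrFun h 1
  simp only [quinticPoint, Matrix.cons_val_zero, Matrix.cons_val_one, Pi.zero_apply, mul_eq_zero,
    pow_eq_zero_iff two_ne_zero] at h0 h1
  rcases eq_or_ne t 0 with rfl | ht
  · refine ⟨rfl, h0.elim id fun h => ?_⟩
    have : A * B * (A + B) * u ^ 2 = 0 := by
      simpa [quadForm, conicCoeff] using h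
    simpa [hc] using this
  rcases eq_or_ne u 0 with rfl | hu
  · refine ⟨h1.elim id fun h => ?_, rfl⟩
    have : A' * B' * (A' + B') * t ^ 2 = 0 := by
      simpa [quadForm, conicCoeff'] using h
    simpa [hc'] using this
  have hQ := h0.resolve_left hu
  have hQ' := h1.resolve_left ht
  rw [quadForm_conicCoeff] at hQ
  rw [quadForm_conicCoeff'] at hQ'
  have hr : (A * B' - A' * B) * (B' * t - B * u) ^ 2 = 0 := by
    linear_combination B' * hQ - B * hQ'
  have hs : (A * B' - A' * B) * (A * u - A' * t) ^ 2 = 0 := by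
    linear_combination A * hQ' - A' * hQ
  have hr' : B' * t - B * u = 0 := by simpa [hE] using hr
  have hs' : A * u - A' * t = 0 := by simpa [hE] using hs
  have : (A * B' - A' * B) * t = 0 := by linear_combination A * hr' + B * hs'
  exact absurd ((mul_eq_zero.mp this).resolve_left hE) ht

end

/-- The vector `v` as a complex number. -/
def cpx (v : Fin 2 → ℝ) : ℂ := v 0 + v 1 * Complex.I

/-- The complex conjugate of `cpx v`. -/
def cpxConj (v : Fin 2 → ℝ) : ℂ := v 0 - v 1 * Complex.I

theorem cpx_ne_zero {v : Fin 2 → ℝ} (hv : v ≠ 0) : cpx v ≠ 0 := by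
  intro h
  apply hv
  rw [cpx, Complex.ext_iff] at h
  ext i
  fin_cases i
  · simpa using h.1
  · simpa using h.2

theorem cpxConj_ne_zero {v : Fin 2 → ℝ} (hv : v ≠ 0) : cpxConj v ≠ 0 := by
  intro h
  apply hv
  rw [cpxConj, Complex.ext_iff] at h
  ext i
  fin_cases i
  · simpa using h.1
  · simpa using h.2

theorem cpxConj_sub_two_mul_ne_zero {v : Fin 2 → ℝ} (hv : v ≠ 0) : cpxConj v - 2 * cpx v ≠ 0 := by
  intro h
  apply hv
  rw [cpxConj, cpx, Complex.ext_iff] at h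
  obtain ⟨h0, h1⟩ := h
  simp at h0 h1
  ext i
  fin_cases i
  · show v 0 = 0
    linarith
  · show v 1 = 0
    linarith

section
variable (d e o : Fin 2 → ℝ)

/-- The coefficients of the form `Q` of `quinticPoint` for the bifurcation curve. -/
def formQ : Fin 3 → ℂ := conicCoeff (cpx e) (-cpx d) (cpxConj e) (-cpxConj d)

/-- The coefficients of the form `Q'` of `quinticPoint` for the bifurcation curve. -/
def formQ' : Fin 3 → ℂ := conicCoeff' (cpx e) (-cpx d) (cpxConj e) (-cpxConj d)

/-- The determinant of the change of parameters from `(r, s)` to `(t, u)`. -/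
def paramDet : ℂ := cpx e * -cpxConj d - cpxConj e * -cpx d

/-- The constants of `isoCoord` for the bifurcation curve; the two scaling factors are those for
which `isoCoord_complexForms` holds. -/
def isoConst : Fin 5 → ℂ :=
  ![paramDet d e ^ 4, Complex.I, o 0, o 1, paramDet d e ^ 3 / 4]

/-- The parametrization of the complexified bifurcation curve. -/
def complexForms (μ : Fin 2 → ℂ) : Fin 3 → ℂ :=
  curveForms (fun i => (d i : ℂ)) (fun i => (e i : ℂ)) (fun i => (o i : ℂ)) μ

/-- The quintic polynomial whose zero locus is the projective closure of the bifurcation curve. -/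
def quinticEquation : MvPolynomial (Fin 3) ℂ :=
  implicitForm (C ∘ formQ d e) (C ∘ formQ' d e) (C ∘ isoConst d e o) X

theorem quinticEquation_isHomogeneous : (quinticEquation d e o).IsHomogeneous 5 :=
  isHomogeneous_implicitForm _ _ _

theorem eval_quinticEquation (v : Fin 3 → ℂ) : eval v (quinticEquation d e o)
    = implicitForm (formQ d e) (formQ' d e) (isoConst d e o) v := by
  rw [quinticEquation, map_implicitForm]
  congr 1 <;> ext <;> simp

theorem isoCoord_complexForms (r s : ℂ) :
    isoCoord (isoConst d e o) (complexForms d e o ![r, s]) =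
      quinticPoint (formQ d e) (formQ' d e) (cpx e * r - cpx d * s)
        (cpxConj e * r - cpxConj d * s) := by
  have hr : -cpxConj d * (cpx e * r - cpx d * s) - -cpx d * (cpxConj e * r - cpxConj d * s)
      = paramDet d e * r := by rw [paramDet]; ring
  have hs : cpx e * (cpxConj e * r - cpxConj d * s) - cpxConj e * (cpx e * r - cpx d * s)
      = paramDet d e * s := by rw [paramDet]; ring
  have hrs : (cpxConj e + -cpxConj d) * (cpx e * r - cpx d * s)
      - (cpx e + -cpx d) * (cpxConj e * r - cpxConj d * s) = paramDet d e * (r - s) := by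
    rw [paramDet]; ring
  have hI := Complex.I_sq
  ext i
  fin_cases i
  · simp only [quinticPoint, formQ, quadForm_conicCoeff, hr, hs, isoCoord, isoConst, complexForms,
      curveForms, Fin.zero_eta, Matrix.cons_val]
    have key : (r * (e 0 : ℂ) - s * d 0 - (r * e 1 - s * d 1) * Complex.I) *
        ((r ^ 2 * (e 0 : ℂ) - s ^ 2 * d 0) + (r ^ 2 * e 1 - s ^ 2 * d 1) * Complex.I) ^ 2
        = (cpxConj e * r - cpxConj d * s) * (cpx e * r ^ 2 - cpx d * s ^ 2) ^ 2 := by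
      simp only [cpx, cpxConj]
      ring
    generalize hp0 : r * (e 0 : ℂ) - s * d 0 = p0 at *
    generalize hp1 : r * (e 1 : ℂ) - s * d 1 = p1 at *
    generalize hq0 : r ^ 2 * (e 0 : ℂ) - s ^ 2 * d 0 = q0 at *
    generalize hq1 : r ^ 2 * (e 1 : ℂ) - s ^ 2 * d 1 = q1 at *
    linear_combination paramDet d e ^ 4 * key
      - paramDet d e ^ 4 * (p0 * q1 ^ 2 - 2 * p1 * q0 * q1 - p1 * q1 ^ 2 * Complex.I) * hI
  · simp only [quinticPoint, formQ', quadForm_conicCoeff', hr, hs, isoCoord, isoConst, complexForms,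
      curveForms, Fin.mk_one, Matrix.cons_val]
    have key : (r * (e 0 : ℂ) - s * d 0 + (r * e 1 - s * d 1) * Complex.I) *
        ((r ^ 2 * (e 0 : ℂ) - s ^ 2 * d 0) - (r ^ 2 * e 1 - s ^ 2 * d 1) * Complex.I) ^ 2
        = (cpx e * r - cpx d * s) * (cpxConj e * r ^ 2 - cpxConj d * s ^ 2) ^ 2 := by
      simp only [cpx, cpxConj]
      ring
    generalize hp0 : r * (e 0 : ℂ) - s * d 0 = p0 at *
    generalize hp1 : r * (e 1 : ℂ) - s * d 1 = p1 at *
    generalize hq0 : r ^ 2 * (e 0 : ℂ) - s ^ 2 * d 0 = q0 at *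
    generalize hq1 : r ^ 2 * (e 1 : ℂ) - s ^ 2 * d 1 = q1 at *
    linear_combination paramDet d e ^ 4 * key
      - paramDet d e ^ 4 * (p0 * q1 ^ 2 - 2 * p1 * q0 * q1 + p1 * q1 ^ 2 * Complex.I) * hI
  · have key : (r * (e 0 : ℂ) - s * d 0) ^ 2 + (r * e 1 - s * d 1) ^ 2
        = (cpx e * r - cpx d * s) * (cpxConj e * r - cpxConj d * s) := by
      simp only [cpx, cpxConj]
      linear_combination (r * (e 1 : ℂ) - s * d 1) ^ 2 * hI
    simp only [quinticPoint, formQ, formQ', conic_sub_eq, hr, hs, hrs, isoCoord, isoConst,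
      complexForms, curveForms, Fin.reduceFinMk, Matrix.cons_val, key]
    ring

end

/-! ### Irreducibility and rationality -/

section
variable {d e : Fin 2 → ℝ} (o : Fin 2 → ℝ)

theorem left_ne_zero_of_wedge (h : d 0 * e 1 - d 1 * e 0 ≠ 0) : d ≠ 0 := by
  rintro rfl
  simp at h

theorem right_ne_zero_of_wedge (h : d 0 * e 1 - d 1 * e 0 ≠ 0) : e ≠ 0 := by
  rintro rfl
  simp at h

theorem sub_ne_zero_of_wedge (h : d 0 * e 1 - d 1 * e 0 ≠ 0) : e - d ≠ 0 := by
  rintro h'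
  rw [sub_eq_zero.mp h'] at h
  exact h (by ring)

theorem paramDet_ne_zero (h : d 0 * e 1 - d 1 * e 0 ≠ 0) : paramDet d e ≠ 0 := by
  have : paramDet d e = ((-2 * (d 0 * e 1 - d 1 * e 0) : ℝ) : ℂ) * Complex.I := by
    simp only [paramDet, cpx, cpxConj]
    push_cast
    ring
  rw [this]
  exact mul_ne_zero (Complex.ofReal_ne_zero.mpr (mul_ne_zero (by norm_num) h)) Complex.I_ne_zero

theorem cpx_sub (d e : Fin 2 → ℝ) : cpx (e - d) = cpx e - cpx d := by
  simp [cpx]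
  ring

theorem cpxConj_sub (d e : Fin 2 → ℝ) : cpxConj (e - d) = cpxConj e - cpxConj d := by
  simp [cpxConj]
  ring

theorem formQ_two_ne_zero (h : d 0 * e 1 - d 1 * e 0 ≠ 0) :
    cpx e * -cpx d * (cpx e + -cpx d) ≠ 0 := by
  rw [← sub_eq_add_neg, ← cpx_sub]
  exact mul_ne_zero (mul_ne_zero (cpx_ne_zero (right_ne_zero_of_wedge h))
    (neg_ne_zero.mpr (cpx_ne_zero (left_ne_zero_of_wedge h))))
    (cpx_ne_zero (sub_ne_zero_of_wedge h))

theorem formQ'_zero_ne_zero (h : d 0 * e 1 - d 1 * e 0 ≠ 0) :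
    cpxConj e * -cpxConj d * (cpxConj e + -cpxConj d) ≠ 0 := by
  rw [← sub_eq_add_neg, ← cpxConj_sub]
  exact mul_ne_zero (mul_ne_zero (cpxConj_ne_zero (right_ne_zero_of_wedge h))
    (neg_ne_zero.mpr (cpxConj_ne_zero (left_ne_zero_of_wedge h))))
    (cpxConj_ne_zero (sub_ne_zero_of_wedge h))

theorem eq_zero_of_quinticPoint_eq_zero (h : d 0 * e 1 - d 1 * e 0 ≠ 0) (t u : ℂ)
    (h0 : quinticPoint (formQ d e) (formQ' d e) t u = 0) : t = 0 ∧ u = 0 :=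
  quinticPoint_conicCoeff_eq_zero (paramDet_ne_zero h) (formQ_two_ne_zero h)
    (formQ'_zero_ne_zero h) t u h0

theorem isoCoord_injective (h : d 0 * e 1 - d 1 * e 0 ≠ 0) :
    Function.Injective (isoCoord (isoConst d e o)) := by
  intro v w hvw
  have hE := paramDet_ne_zero h
  have h0 := congrFun hvw 0
  have h1 := congrFun hvw 1
  have h2 := congrFun hvw 2
  simp only [isoCoord, isoConst, Matrix.cons_val, mul_eq_mul_left_iff,
    div_eq_zero_iff, pow_eq_zero_iff, hE, ne_eq, OfNat.ofNat_ne_zero, not_false_eq_true,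
    or_false] at h0 h1 h2
  rw [h2] at h0 h1
  have h3 : v 0 = w 0 := by linear_combination (h0 + h1) / 2
  have h4 : Complex.I * (v 1 - w 1) = 0 := by linear_combination (h0 - h1) / 2
  have h5 : v 1 = w 1 := sub_eq_zero.mp ((mul_eq_zero.mp h4).resolve_left Complex.I_ne_zero)
  ext i
  fin_cases i <;> assumption

theorem complexForms_eq_zero (h : d 0 * e 1 - d 1 * e 0 ≠ 0) {μ : Fin 2 → ℂ}
    (h0 : complexForms d e o μ = 0) : μ = 0 := by
  have hμ : μ = ![μ 0, μ 1] := by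
    ext i
    fin_cases i <;> rfl
  have hz := isoCoord_complexForms d e o (μ 0) (μ 1)
  rw [← hμ, h0, show isoCoord (isoConst d e o) 0 = 0 by
    ext i; fin_cases i <;> simp [isoCoord]] at hz
  obtain ⟨ht, hu⟩ := eq_zero_of_quinticPoint_eq_zero h _ _ hz.symm
  have hE := paramDet_ne_zero h
  have hr : paramDet d e * μ 0 = 0 := by
    rw [paramDet]; linear_combination -cpxConj d * ht + cpx d * hu
  have hs : paramDet d e * μ 1 = 0 := by
    rw [paramDet]; linear_combination cpx e * hu - cpxConj e * ht
  ext i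
  fin_cases i
  · simpa [hE] using hr
  · simpa [hE] using hs

theorem eval_quinticEquation_eq_zero_iff (h : d 0 * e 1 - d 1 * e 0 ≠ 0) (v : Fin 3 → ℂ) :
    eval v (quinticEquation d e o) = 0 ↔ ∃ μ, v = complexForms d e o μ := by
  have hE := paramDet_ne_zero h
  rw [eval_quinticEquation, implicitForm,
    resultantForm_moving_eq_zero_iff (eq_zero_of_quinticPoint_eq_zero h)]
  constructor
  · rintro ⟨t, u, htu⟩
    refine ⟨![(-cpxConj d * t + cpx d * u) / paramDet d e,
      (cpx e * u - cpxConj e * t) / paramDet d e], isoCoord_injective o h ?_⟩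
    rw [htu, isoCoord_complexForms]
    congr 1
    · field_simp
      rw [paramDet]
      ring
    · field_simp
      rw [paramDet]
      ring
  · rintro ⟨μ, rfl⟩
    have hμ : μ = ![μ 0, μ 1] := by
      ext i
      fin_cases i <;> rfl
    rw [hμ]
    exact ⟨_, _, isoCoord_complexForms d e o _ _⟩

/-- The points `(1 : -i : 0)` and `(1 : i : 0)` belong to the parameters `t = 0` and `u = 0`. -/
theorem eval_quinticEquation_cyclic (x : ℂ) :
    eval ![x, -Complex.I * x, 0] (quinticEquation d e o) = 0 ∧
      eval ![x, Complex.I * x, 0] (quinticEquation d e o) = 0 := by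
  constructor <;> rw [eval_quinticEquation]
  · have : isoCoord (isoConst d e o) ![x, -Complex.I * x, 0]
        = ![paramDet d e ^ 4 * (2 * x), 0, 0] := by
      ext i
      fin_cases i <;> simp [isoCoord, isoConst, ← mul_assoc]
      ring
    rw [implicitForm, this]
    simp [resultantForm, movingQuad, movingCubic]
  · have : isoCoord (isoConst d e o) ![x, Complex.I * x, 0]
        = ![0, paramDet d e ^ 4 * (2 * x), 0] := by
      ext i
      fin_cases i <;> simp [isoCoord, isoConst, ← mul_assoc]
      ring
    rw [implicitForm, this]
    simp [resultantForm, movingQuad, movingCubic]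

theorem complexForms_eq_eval (d e o : Fin 2 → ℝ) (μ : Fin 2 → ℂ) : complexForms d e o μ =
    fun i => eval μ (curveForms (fun i => C (d i : ℂ)) (fun i => C (e i : ℂ))
      (fun i => C (o i : ℂ)) X i) := by
  ext i
  rw [map_curveForms]
  simp only [complexForms, Function.comp_def, eval_C, eval_X]

theorem irreducible_quinticEquation (h : d 0 * e 1 - d 1 * e 0 ≠ 0) :
    Irreducible (quinticEquation d e o) := by
  refine irreducible_of_zeros_eq_range (by norm_num) (quinticEquation_isHomogeneous d e o)
    (curveForms (fun i => C (d i : ℂ)) (fun i => C (e i : ℂ)) (fun i => C (o i : ℂ)) X)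
    (fun v => ?_) (eval_quinticEquation_cyclic o 1).1
    (eval_quinticEquation_cyclic o 2).2 fun h0 => ?_
  · simp only [eval_quinticEquation_eq_zero_iff o h, complexForms_eq_eval]
  -- The sum of the two vectors has the isotropic coordinates `(2 : 4 : 0)`; a point of the curve on
  -- the line at infinity that is not cyclic has two isotropic coordinates of equal absolute value.
  · have hE := paramDet_ne_zero h
    rw [eval_quinticEquation, implicitForm,
      resultantForm_moving_eq_zero_iff (eq_zero_of_quinticPoint_eq_zero h)] at h0
    obtain ⟨t, u, htu⟩ := h0
    have hv : isoCoord (isoConst d e o) (![1, -Complex.I * 1, 0] + ![2, Complex.I * 2, 0])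
        = ![2 * paramDet d e ^ 4, 4 * paramDet d e ^ 4, 0] := by
      have hI := Complex.I_sq
      ext i
      fin_cases i
      · simp [isoCoord, isoConst]
        linear_combination paramDet d e ^ 4 * hI
      · simp [isoCoord, isoConst]
        linear_combination -paramDet d e ^ 4 * hI
      · simp [isoCoord, isoConst]
    rw [hv] at htu
    have e0 := congrFun htu 0
    have e1 := congrFun htu 1
    have e2 := congrFun htu 2
    simp only [quinticPoint, Matrix.cons_val] at e0 e1 e2
    have ht : t ≠ 0 := by
      rintro rfl
      rw [zero_mul] at e1
      exact mul_ne_zero (by norm_num) (pow_ne_zero 4 hE) e1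
    have hu : u ≠ 0 := by
      rintro rfl
      rw [zero_mul] at e0
      exact mul_ne_zero (by norm_num) (pow_ne_zero 4 hE) e0
    have hL := (mul_eq_zero.mp e2.symm).resolve_left (mul_ne_zero ht hu)
    have hut : u = 2 * t := by
      have : 2 * paramDet d e ^ 4 * (u - 2 * t) = 0 := by
        linear_combination u * e0 - t * e1
          + (u * quadForm (formQ d e) t u + t * quadForm (formQ' d e) t u) * hL
      exact sub_eq_zero.mp ((mul_eq_zero.mp this).resolve_left
        (mul_ne_zero (by norm_num) (pow_ne_zero 4 hE)))
    rw [hut, formQ, formQ', conic_sub_eq] at hL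
    have h1 := cpxConj_sub_two_mul_ne_zero (left_ne_zero_of_wedge h)
    have h2 := cpxConj_sub_two_mul_ne_zero (right_ne_zero_of_wedge h)
    have h3 := cpxConj_sub_two_mul_ne_zero (sub_ne_zero_of_wedge h)
    rw [cpx_sub, cpxConj_sub] at h3
    have : t ^ 3 * ((cpxConj d - 2 * cpx d) * (cpxConj e - 2 * cpx e) *
        (cpxConj e - cpxConj d - 2 * (cpx e - cpx d))) = 0 := by
      linear_combination hL
    exact mul_ne_zero (pow_ne_zero 3 ht) (mul_ne_zero (mul_ne_zero h1 h2) h3) this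

theorem curveForms_two_ne_zero (h : d 0 * e 1 - d 1 * e 0 ≠ 0) :
    curveForms d e o ![2, 1] 2 ≠ 0 := by
  have : 0 < (2 * e 0 - d 0) ^ 2 + (2 * e 1 - d 1) ^ 2 := by
    by_contra hle
    push Not at hle
    have h0 : 2 * e 0 - d 0 = 0 := pow_eq_zero_iff two_ne_zero |>.mp
      (le_antisymm (by linarith [sq_nonneg (2 * e 1 - d 1)]) (sq_nonneg _))
    have h1 : 2 * e 1 - d 1 = 0 := pow_eq_zero_iff two_ne_zero |>.mp
      (le_antisymm (by linarith [sq_nonneg (2 * e 0 - d 0)]) (sq_nonneg _))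
    apply h
    linear_combination e 0 * h1 - e 1 * h0
  rw [curveForms_two]
  simp only [Matrix.cons_val_zero, Matrix.cons_val_one, one_mul]
  norm_num
  exact this.ne'

/-- The parametrization in the affine parameter `θ = r / s`. -/
def affineForms (d e o : Fin 2 → ℝ) : Fin 3 → Polynomial ℂ :=
  curveForms (fun i => Polynomial.C (d i : ℂ)) (fun i => Polynomial.C (e i : ℂ))
    (fun i => Polynomial.C (o i : ℂ)) ![Polynomial.X, 1]

theorem eval_affineForms (d e o : Fin 2 → ℝ) (θ : ℂ) (i : Fin 3) :
    (affineForms d e o i).eval θ = complexForms d e o ![θ, 1] i := by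
  rw [affineForms, ← Polynomial.coe_evalRingHom, map_curveForms, complexForms]
  congr 1
  · ext; simp
  · ext; simp
  · ext; simp
  · ext i; fin_cases i <;> simp

theorem affineForms_two_ne_zero (h : d 0 * e 1 - d 1 * e 0 ≠ 0) : affineForms d e o 2 ≠ 0 := by
  intro h0
  have h1 := eval_affineForms d e o 2 2
  have h2 := map_curveForms Complex.ofRealHom d e o ![2, 1] 2
  have h3 : Complex.ofRealHom ∘ (![2, 1] : Fin 2 → ℝ) = ![2, 1] := by
    ext i
    fin_cases i <;> simp
  rw [h3] at h2
  rw [h0, Polynomial.eval_zero] at h1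
  exact curveForms_two_ne_zero o h (Complex.ofReal_eq_zero.mp (h2.trans h1.symm))

theorem smul_ratPoint {θ : ℂ} (hθ : (affineForms d e o 2).eval θ ≠ 0) :
    (affineForms d e o 2).eval θ •
      ![ratPoint (affineForms d e o) θ 0, ratPoint (affineForms d e o) θ 1, 1]
      = complexForms d e o ![θ, 1] := by
  ext i
  rw [← eval_affineForms]
  fin_cases i
  · exact mul_div_cancel₀ _ hθ
  · exact mul_div_cancel₀ _ hθ
  · simp

theorem affinePart_eq (h : d 0 * e 1 - d 1 * e 0 ≠ 0) :
    affinePart (projZeroLocus (quinticEquation d e o)) =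
      {v | ∃ θ, (affineForms d e o 2).eval θ ≠ 0 ∧ v = ratPoint (affineForms d e o) θ} := by
  ext v
  change affinePoint (v 0) (v 1) ∈ projZeroLocus (quinticEquation d e o) ↔ _
  rw [affinePoint, mk_mem_projZeroLocus (quinticEquation_isHomogeneous d e o)]
  constructor
  · intro hv
    obtain ⟨μ, hμ⟩ := (eval_quinticEquation_eq_zero_iff o h _).mp hv
    have h2 : complexForms d e o μ 2 = 1 := by rw [← hμ]; simp
    have h1 : μ 1 ≠ 0 := by
      intro h1
      simp [complexForms, curveForms_two, h1] at h2
    have hμ' : μ = μ 1 • ![μ 0 / μ 1, 1] := by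
      ext i
      fin_cases i
      · simp [mul_div_cancel₀ _ h1]
      · simp
    rw [complexForms, hμ', curveForms_smul] at hμ h2
    have hden : (affineForms d e o 2).eval (μ 0 / μ 1) ≠ 0 := by
      rw [eval_affineForms]
      intro h0
      rw [complexForms] at h0
      rw [Pi.smul_apply, h0, smul_zero] at h2
      exact zero_ne_one h2
    refine ⟨μ 0 / μ 1, hden, ?_⟩
    have hcoord : ∀ i : Fin 2, v i
        = μ 1 ^ 5 * (affineForms d e o i.castSucc).eval (μ 0 / μ 1) := by
      intro i
      rw [eval_affineForms, complexForms]
      have := congrFun hμ i.castSucc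
      rw [Pi.smul_apply, smul_eq_mul] at this
      rw [← this]
      fin_cases i <;> rfl
    have hden' : μ 1 ^ 5 * (affineForms d e o 2).eval (μ 0 / μ 1) = 1 := by
      rw [eval_affineForms, complexForms]
      exact h2
    ext i
    rw [hcoord, ratPoint, eq_div_iff hden]
    linear_combination (affineForms d e o i.castSucc).eval (μ 0 / μ 1) * hden'
  · rintro ⟨θ, hθ, rfl⟩
    rw [← eval_smul_eq_zero_iff (quinticEquation_isHomogeneous d e o) hθ, smul_ratPoint o hθ,
      eval_quinticEquation_eq_zero_iff o h]
    exact ⟨_, rfl⟩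

/-- The remainder of the moving cubic modulo the moving quadratic determines the parameter; it is
not zero, since it is not zero at the cyclic point with the parameter `t = 0`. -/
theorem isRationalCurve_quintic (h : d 0 * e 1 - d 1 * e 0 ≠ 0) :
    IsRationalCurve (projZeroLocus (quinticEquation d e o)) := by
  have hE := paramDet_ne_zero h
  have hg := affineForms_two_ne_zero o h
  let T : (Fin 3 → ℂ) → ℂ := inverseT (formQ d e) (formQ' d e) (isoConst d e o)
  let U : (Fin 3 → ℂ) → ℂ := inverseU (formQ d e) (formQ' d e) (isoConst d e o)
  let w : Fin 3 → MvPolynomial (Fin 2) ℂ := ![X 0, X 1, 1]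
  let T' : MvPolynomial (Fin 2) ℂ :=
    inverseT (C ∘ formQ d e) (C ∘ formQ' d e) (C ∘ isoConst d e o) w
  let U' : MvPolynomial (Fin 2) ℂ :=
    inverseU (C ∘ formQ d e) (C ∘ formQ' d e) (C ∘ isoConst d e o) w
  have hw : ∀ v : Fin 2 → ℂ, eval v ∘ w = ![v 0, v 1, 1] := by
    intro v
    ext i
    fin_cases i <;> simp [w]
  have hC : ∀ {ι : Type} (v : Fin 2 → ℂ) (k : ι → ℂ), eval v ∘ C ∘ k = k := by
    intro ι v k
    ext
    simp
  have hT' : ∀ v : Fin 2 → ℂ, eval v T' = T ![v 0, v 1, 1] := fun v => by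
    simp only [T', T, map_inverseT, hC, hw]
  have hU' : ∀ v : Fin 2 → ℂ, eval v U' = U ![v 0, v 1, 1] := fun v => by
    simp only [U', U, map_inverseU, hC, hw]
  have hrel : ∀ θ, (affineForms d e o 2).eval θ ≠ 0 →
      eval (ratPoint (affineForms d e o) θ) T' * (cpx e * θ - cpx d)
        + eval (ratPoint (affineForms d e o) θ) U' * (cpxConj e * θ - cpxConj d) = 0 := by
    intro θ hθ
    rw [hT', hU']
    -- The affine point is the value of the forms at `(z θ, z)`.
    obtain ⟨z, hz⟩ := IsAlgClosed.exists_pow_nat_eq ((affineForms d e o 2).eval θ)⁻¹ (n := 5)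
      (by norm_num)
    have hz0 : z ≠ 0 := by
      rintro rfl
      exact inv_ne_zero hθ (by simpa using hz.symm)
    have hpt : ![ratPoint (affineForms d e o) θ 0, ratPoint (affineForms d e o) θ 1, 1]
        = complexForms d e o ![z * θ, z] := by
      have := smul_ratPoint o hθ
      rw [show (![z * θ, z] : Fin 2 → ℂ) = z • ![θ, 1] by ext i; fin_cases i <;> simp,
        complexForms, curveForms_smul, hz, ← complexForms, ← this, smul_smul, inv_mul_cancel₀ hθ,
        one_smul]
    have hq := isoCoord_complexForms d e o (z * θ) z
    rw [← hpt] at hq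
    have hu : cpxConj e * (z * θ) - cpxConj d * z ≠ 0 := by
      intro hu
      have := congrFun hq 2
      rw [hu] at this
      simp [isoCoord, isoConst, quinticPoint, hE] at this
    have := remT_mul_add_remU_mul
      (quadForm_movingQuad_quinticPoint (formQ d e) (formQ' d e) _ _)
      (cubicForm_movingCubic_quinticPoint (formQ d e) (formQ' d e)
        (cpx e * (z * θ) - cpx d * z) (cpxConj e * (z * θ) - cpxConj d * z)) hu
    rw [← hq] at this
    change T _ * _ + U _ * _ = 0 at this
    refine mul_left_cancel₀ hz0 ?_
    linear_combination this
  refine isRationalCurve_of_param hg (affinePart_eq o h) (C (cpx e) * T' + C (cpxConj e) * U')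
    (-(C (cpx d) * T' + C (cpxConj d) * U')) (fun θ hθ => ?_) ?_
  · simp only [map_add, map_neg, map_mul, eval_C]
    linear_combination hrel θ hθ
  · -- It suffices that `T` does not vanish identically on the curve: by `hrel`, if the coefficient
    -- of `θ` and hence also the constant one vanish, then so does `T`.
    obtain ⟨θ, hθ, hT⟩ : ∃ θ, (affineForms d e o 2).eval θ ≠ 0 ∧
        T (complexForms d e o ![θ, 1]) ≠ 0 := by
      by_contra hcon
      push Not at hcon
      let H : Polynomial ℂ := inverseT (Polynomial.C ∘ formQ d e) (Polynomial.C ∘ formQ' d e)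
        (Polynomial.C ∘ isoConst d e o) (affineForms d e o)
      have hH : ∀ θ, H.eval θ = T (complexForms d e o ![θ, 1]) := by
        intro θ
        simp only [H, T]
        rw [← Polynomial.coe_evalRingHom, map_inverseT]
        congr 1
        · ext; simp
        · ext; simp
        · ext; simp
        · ext i
          exact eval_affineForms d e o θ i
      have hH0 : H = 0 := polynomial_eq_zero_of_forall_ne hg fun θ hθ => by rw [hH, hcon θ hθ]
      have he := cpx_ne_zero (right_ne_zero_of_wedge h)
      have h0 := hH (cpx d / cpx e)
      rw [hH0, Polynomial.eval_zero] at h0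
      have hu : cpxConj e * (cpx d / cpx e) - cpxConj d * 1 ≠ 0 := by
        intro hu
        apply hE
        field_simp at hu
        rw [paramDet]
        linear_combination hu
      have ht : cpx e * (cpx d / cpx e) - cpx d * 1 = 0 := by
        field_simp
        ring
      simp only [T, inverseT] at h0
      rw [isoCoord_complexForms, ht] at h0
      have hc := formQ_two_ne_zero h
      have hc' := formQ'_zero_ne_zero h
      have k0 : formQ' d e 0 ≠ 0 := hc'
      have k2 : formQ d e 2 ≠ 0 := hc
      simp [remT, movingQuad, movingCubic, quinticPoint, quadForm] at h0
      simp [k0, k2] at h0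
      exact hu (by simpa using h0)
    refine ⟨θ, hθ, fun hR => ?_⟩
    have hrel' := hrel θ hθ
    simp only [map_add, map_mul, eval_C] at hR
    rw [← smul_ratPoint o hθ] at hT
    simp only [T] at hT
    rw [inverseT_smul] at hT
    apply right_ne_zero_of_mul hT
    change T _ = 0
    rw [← hT']
    refine (mul_eq_zero.mp (?_ : paramDet d e * _ = 0)).resolve_left hE
    rw [paramDet]
    linear_combination (-cpxConj d + θ * cpxConj e) * hR - cpxConj e * hrel'

end

/-! ### Ideal points -/

section
variable {d e : Fin 2 → ℝ} (o : Fin 2 → ℝ)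

/-- The third form factors as `4 t u r s (r - s)`; the five ideal points belong to its five linear
factors. -/
theorem eval_quinticEquation_eq_zero_iff_of_infinite (h : d 0 * e 1 - d 1 * e 0 ≠ 0)
    {v : Fin 3 → ℂ} (hv : v 2 = 0) : eval v (quinticEquation d e o) = 0 ↔
      (∃ x : ℂ, v = x • ![((e 0 - d 0 : ℝ) : ℂ), ((e 1 - d 1 : ℝ) : ℂ), 0]) ∨
      (∃ x : ℂ, v = x • ![(e 0 : ℂ), (e 1 : ℂ), 0]) ∨
      (∃ x : ℂ, v = x • ![(d 0 : ℂ), (d 1 : ℂ), 0]) ∨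
      (∃ x : ℂ, v = x • ![1, Complex.I, 0]) ∨ (∃ x : ℂ, v = x • ![1, -Complex.I, 0]) := by
  have hF := quinticEquation_isHomogeneous d e o
  have hI := Complex.I_sq
  constructor
  · intro hz
    obtain ⟨μ, rfl⟩ := (eval_quinticEquation_eq_zero_iff o h v).mp hz
    obtain ⟨r, s, rfl⟩ : ∃ r s, μ = ![r, s] := ⟨μ 0, μ 1, by ext i; fin_cases i <;> rfl⟩
    have hiso := isoCoord_complexForms d e o r s
    have hfac : (cpx e * r - cpx d * s) * (cpxConj e * r - cpxConj d * s) *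
        (r * s * (r - s)) = 0 := by
      rw [complexForms, curveForms_two] at hv
      simp only [Matrix.cons_val] at hv
      simp only [cpx, cpxConj]
      linear_combination (1 / 4 : ℂ) * hv
        - (r * e 1 - s * d 1) ^ 2 * (r * s * (r - s)) * hI
    have hE := pow_ne_zero 4 (paramDet_ne_zero h)
    have h0 := congrFun hiso 0
    have h1 := congrFun hiso 1
    simp only [isoCoord, isoConst, quinticPoint, Matrix.cons_val, hv, mul_zero, sub_zero] at h0 h1
    have hvec : ∀ {x y z : ℂ}, complexForms d e o ![r, s] 0 = z * x →
        complexForms d e o ![r, s] 1 = z * y →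
        ∃ z : ℂ, complexForms d e o ![r, s] = z • ![x, y, 0] := by
      intro x y z hx hy
      refine ⟨z, ?_⟩
      ext i
      fin_cases i
      · exact hx
      · exact hy
      · simpa using hv
    rcases mul_eq_zero.mp hfac with htu | hrs
    · rcases mul_eq_zero.mp htu with ht | hu
      · rw [ht, zero_mul] at h1
        have h1' := (mul_eq_zero.mp h1).resolve_left hE
        refine Or.inr (Or.inr (Or.inr (Or.inr (hvec (z := complexForms d e o ![r, s] 0)
          (by ring) ?_))))
        linear_combination Complex.I * h1' + complexForms d e o ![r, s] 1 * hI
      · rw [hu, zero_mul] at h0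
        have h0' := (mul_eq_zero.mp h0).resolve_left hE
        refine Or.inr (Or.inr (Or.inr (Or.inl (hvec (z := complexForms d e o ![r, s] 0)
          (by ring) ?_))))
        linear_combination -Complex.I * h0' + complexForms d e o ![r, s] 1 * hI
    · rcases mul_eq_zero.mp hrs with hrs | hsub
      · rcases mul_eq_zero.mp hrs with rfl | rfl
        · refine Or.inr (Or.inr (Or.inl (hvec
            (z := -s ^ 5 * ((d 0 : ℂ) ^ 2 + (d 1 : ℂ) ^ 2)) ?_ ?_))) <;>
          · simp [complexForms, curveForms]
            ring
        · refine Or.inr (Or.inl (hvec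
            (z := r ^ 5 * ((e 0 : ℂ) ^ 2 + (e 1 : ℂ) ^ 2)) ?_ ?_)) <;>
          · simp [complexForms, curveForms]
            ring
      · obtain rfl := sub_eq_zero.mp hsub
        refine Or.inl (hvec
          (z := r ^ 5 * (((e 0 - d 0 : ℝ) : ℂ) ^ 2 + ((e 1 - d 1 : ℝ) : ℂ) ^ 2)) ?_ ?_) <;>
        · simp [complexForms, curveForms]
          ring
  · have hsq : ∀ {v : Fin 2 → ℝ}, v ≠ 0 → ((v 0 : ℂ) ^ 2 + (v 1 : ℂ) ^ 2) ≠ 0 := by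
      intro v hv
      have : (v 0 : ℂ) ^ 2 + (v 1 : ℂ) ^ 2 = cpx v * cpxConj v := by
        rw [cpx, cpxConj]
        linear_combination (v 1 : ℂ) ^ 2 * hI
      rw [this]
      exact mul_ne_zero (cpx_ne_zero hv) (cpxConj_ne_zero hv)
    have hdir : ∀ {w : Fin 3 → ℂ} {y : ℂ} (μ : Fin 2 → ℂ), y ≠ 0 → y • w = complexForms d e o μ →
        ∀ x : ℂ, eval (x • w) (quinticEquation d e o) = 0 := by
      intro w y μ hy hw x
      rcases eq_or_ne x 0 with rfl | hx
      · rw [zero_smul, eval_zero, constantCoeff_eq]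
        exact hF.coeff_eq_zero (by simp)
      · rw [eval_smul_eq_zero_iff hF hx, ← eval_smul_eq_zero_iff hF hy, hw,
          eval_quinticEquation_eq_zero_iff o h]
        exact ⟨μ, rfl⟩
    have hsub := hsq (sub_ne_zero_of_wedge h)
    rintro (⟨x, rfl⟩ | ⟨x, rfl⟩ | ⟨x, rfl⟩ | ⟨x, rfl⟩ | ⟨x, rfl⟩)
    · refine hdir ![1, 1] hsub ?_ x
      ext i
      fin_cases i <;> simp [complexForms, curveForms] <;> ring
    · refine hdir ![1, 0] (hsq (right_ne_zero_of_wedge h)) ?_ x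
      ext i
      fin_cases i <;> simp [complexForms, curveForms] <;> ring
    · refine hdir ![0, 1] (neg_ne_zero.mpr (hsq (left_ne_zero_of_wedge h))) ?_ x
      ext i
      fin_cases i <;> simp [complexForms, curveForms] <;> ring
    · rw [show x • ![1, Complex.I, 0] = ![x, Complex.I * x, 0] by
        ext i; fin_cases i <;> simp [mul_comm]]
      exact (eval_quinticEquation_cyclic o x).2
    · rw [show x • ![1, -Complex.I, 0] = ![x, -Complex.I * x, 0] by
        ext i; fin_cases i <;> simp [mul_comm]]
      exact (eval_quinticEquation_cyclic o x).1

end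

/-! ### The bifurcation curve -/

theorem wedge_ne_zero_of_not_collinear {m : Fin 3 → Plane}
    (hm : ¬ Collinear ℝ {m 0, m 1, m 2}) : wedge (disp m 1 0) (disp m 2 0) ≠ 0 := by
  intro hw
  apply hm
  rw [collinear_iff_of_mem (p₀ := m 0) (by simp)]
  rw [wedge] at hw
  by_cases hd : disp m 1 0 = 0
  · refine ⟨disp m 2 0, ?_⟩
    rintro p (rfl | rfl | rfl)
    · exact ⟨0, by simp⟩
    · exact ⟨0, by simpa [disp, sub_eq_zero] using hd⟩
    · exact ⟨1, by simp [disp]⟩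
  · refine ⟨disp m 1 0, ?_⟩
    rintro p (rfl | rfl | rfl)
    · exact ⟨0, by simp⟩
    · exact ⟨1, by simp [disp]⟩
    · obtain ⟨r, hr⟩ : ∃ r : ℝ, disp m 2 0 = r • disp m 1 0 := by
        by_cases h0 : disp m 1 0 0 = 0
        · have h1 : disp m 1 0 1 ≠ 0 := by
            intro h1
            apply hd
            ext i
            fin_cases i <;> assumption
          refine ⟨disp m 2 0 1 / disp m 1 0 1, ?_⟩
          rw [h0, zero_mul, zero_sub, neg_eq_zero] at hw
          have h2 := (mul_eq_zero.mp hw).resolve_left h1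
          ext i
          fin_cases i
          · simp [h0, h2]
          · simp [h1]
        · refine ⟨disp m 2 0 0 / disp m 1 0 0, ?_⟩
          ext i
          fin_cases i
          · simp [h0]
          · show disp m 2 0 1 = disp m 2 0 0 / disp m 1 0 0 * disp m 1 0 1
            field_simp
            linear_combination hw
      exact ⟨r, by rw [← hr]; simp [disp]⟩

/-- The real forms that parametrize the bifurcation curve. -/
def bifurcationForms (m : Fin 3 → Plane) : Fin 3 → MvPolynomial (Fin 2) ℝ :=
  curveForms (C ∘ disp m 1 0) (C ∘ disp m 2 0) (C ∘ m 0) X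

theorem eval_bifurcationForms (m : Fin 3 → Plane) (μ : Fin 2 → ℝ) (i : Fin 3) :
    eval μ (bifurcationForms m i) = curveForms (disp m 1 0) (disp m 2 0) (m 0) μ i := by
  rw [bifurcationForms, map_curveForms]
  congr 1 <;> ext <;> simp

theorem aeval_bifurcationForms (m : Fin 3 → Plane) (μ : Fin 2 → ℂ) (i : Fin 3) :
    aeval μ (bifurcationForms m i) = complexForms (disp m 1 0) (disp m 2 0) (m 0) μ i := by
  rw [bifurcationForms, ← AlgHom.coe_toRingHom, map_curveForms, complexForms]
  congr 1 <;> ext <;> simp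

theorem bifurcationForms_two_ne_zero {m : Fin 3 → Plane}
    (hm : wedge (disp m 1 0) (disp m 2 0) ≠ 0) : bifurcationForms m 2 ≠ 0 := by
  intro h
  have := eval_bifurcationForms m ![2, 1] 2
  rw [h, map_zero] at this
  exact curveForms_two_ne_zero (m 0) hm this.symm

theorem isParametrizedBy_bifurcationForms {m : Fin 3 → Plane}
    (hm : wedge (disp m 1 0) (disp m 2 0) ≠ 0) :
    IsParametrizedBy (bifurcationCurve m) 5 (bifurcationForms m) := by
  refine ⟨fun i => isHomogeneous_curveForms _ _ _ i, fun μ hμ => ?_, ?_⟩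
  · by_contra hcon
    push Not at hcon
    refine hμ (complexForms_eq_zero (m 0) hm (funext fun i => ?_))
    rw [← aeval_bifurcationForms, hcon i, Pi.zero_apply]
  · ext x
    rw [mem_bifurcationCurve_iff hm]
    simp only [eval_bifurcationForms, Fin.forall_fin_two]
    rfl

theorem projClosure_bifurcationCurve {m : Fin 3 → Plane}
    (hm : wedge (disp m 1 0) (disp m 2 0) ≠ 0) : projClosure (bifurcationCurve m) =
      projZeroLocus (quinticEquation (disp m 1 0) (disp m 2 0) (m 0)) := by
  refine projClosure_eq_projZeroLocus (isParametrizedBy_bifurcationForms hm)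
    (bifurcationForms_two_ne_zero hm) (quinticEquation_isHomogeneous _ _ _) fun v => ?_
  rw [eval_quinticEquation_eq_zero_iff (m 0) hm]
  simp only [aeval_bifurcationForms]

theorem idealPoints_bifurcationCurve {m : Fin 3 → Plane}
    (hm : wedge (disp m 1 0) (disp m 2 0) ≠ 0) : idealPoints (bifurcationCurve m) =
      idealPoints (affineSpan ℝ {m 1, m 2}) ∪ idealPoints (affineSpan ℝ {m 0, m 2}) ∪
      idealPoints (affineSpan ℝ {m 0, m 1}) ∪ cyclicPoints := by
  have h12 : m 1 ≠ m 2 := by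
    intro h
    simp [wedge, disp, h] at hm
    exact hm (by ring)
  have h02 : m 0 ≠ m 2 := by
    intro h
    simp [wedge, disp, h] at hm
  have h01 : m 0 ≠ m 1 := by
    intro h
    simp [wedge, disp, h] at hm
  rw [idealPoints_affineSpan_pair h12, idealPoints_affineSpan_pair h02,
    idealPoints_affineSpan_pair h01, idealPoints, projClosure_bifurcationCurve hm]
  ext p
  induction p using Projectivization.ind with
  | h v hv =>
    have hdisp : ∀ i : Fin 2, m 2 i - m 1 i = disp m 2 0 i - disp m 1 0 i := fun i => by
      simp [disp]
    simp only [Set.mem_inter_iff, mem_projZeroLocus_X_two, cyclicPoints, Set.mem_union,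
      Set.mem_singleton_iff, Set.mem_insert_iff, Projectivization.mk_eq_mk_iff',
      mk_mem_projZeroLocus (quinticEquation_isHomogeneous _ _ _), or_assoc, hdisp]
    by_cases hv2 : v 2 = 0
    · rw [eval_quinticEquation_eq_zero_iff_of_infinite (m 0) hm hv2]
      simp only [hv2, and_true, eq_comm (a := v)]
      rfl
    · simp only [hv2, and_false, false_iff]
      rintro (⟨x, rfl⟩ | ⟨x, rfl⟩ | ⟨x, rfl⟩ | ⟨x, rfl⟩ | ⟨x, rfl⟩) <;> simp at hv2

end TDOA

theorem mainTheorem3 (m : Fin 3 → TDOA.Plane) (hm : ¬ Collinear ℝ {m 0, m 1, m 2}) :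
    TDOA.IsIrredCurveOfDegree (TDOA.projClosure (TDOA.bifurcationCurve m)) 5 ∧
    TDOA.IsRationalCurve (TDOA.projClosure (TDOA.bifurcationCurve m)) ∧
    (∃ P : Fin 3 → MvPolynomial (Fin 2) ℝ,
      TDOA.IsParametrizedBy (TDOA.bifurcationCurve m) 5 P) ∧
    TDOA.idealPoints (TDOA.bifurcationCurve m) =
      TDOA.idealPoints (affineSpan ℝ {m 1, m 2}) ∪
      TDOA.idealPoints (affineSpan ℝ {m 0, m 2}) ∪
      TDOA.idealPoints (affineSpan ℝ {m 0, m 1}) ∪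
      TDOA.cyclicPoints := by
  have hw := TDOA.wedge_ne_zero_of_not_collinear hm
  refine ⟨⟨TDOA.quinticEquation (TDOA.disp m 1 0) (TDOA.disp m 2 0) (m 0),
    TDOA.quinticEquation_isHomogeneous _ _ _, TDOA.irreducible_quinticEquation _ hw,
    TDOA.projClosure_bifurcationCurve hw⟩, ?_, ⟨_, TDOA.isParametrizedBy_bifurcationForms hw⟩,
    TDOA.idealPoints_bifurcationCurve hw⟩
  rw [TDOA.projClosure_bifurcationCurve hw]
  exact TDOA.isRationalCurve_quintic _ hw

end
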